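/- Let $(M,g)$ be a connected smooth Riemannian surface (a Hausdorff smooth $2$-manifold without boundary with a smooth Riemannian metric), not necessarily orientable. Let $X$ be a smooth complete vector field on $M$, i.e. one that generates a global flow $(e^{tX})_{t\in\mathbb R}$ (a smooth one-parameter group of diffeomorphisms of $M$), and let $\vec X$ be its complete lift: the vector field on $TM$ that is the infinitesimal generator of the one-parameter group $(e^{tX})_*$, $t\in\mathbb R$, of diffeomorphisms of $TM$. For an open set $U\subset M$ with an orientation, and a nonzero $R\in T_xM$, $x\in U$, let $R^{\perp}\in T_xM$ be the vector orthogonal to $R$, with $|R^\perp|=|R|$ and $(R,R^\perp)$ positively oriented. Let $f_1=f_1^U$ be the vector field on $\{(x,R)\in TM: x\in U,\ R\neq 0\}$ whose integral curves $(x(t),R(t))$ are the solutions of $$\dot x=R^{\perp},\qquad D_tR=-R^{\perp},$$ where $D_t$ is the covariant derivative along $x(t)$ of the Levi-Civita connection; in the coordinates of $TM$ induced by coordinates of $M$, $f_1=R^\perp\partial_x-(R^\perp+\Gamma(R^\perp,R))\partial_R$ with $\Gamma$ given by the Christoffel symbols. Let $(U_i)_{i\in I}$ be any cover of $M$ by oriented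 open sets (if $M$ is oriented one may take the single set $U=M$). Then $X$ is the infinitesimal generator of a one-parameter group of homotheties of $(M,g)$, that is, of a smooth one-parameter group $(\varphi_t)_{t\in\mathbb R}$ of diffeomorphisms such that for every $t$ there is a constant $c_t>0$ with $\varphi_t^*g=c_t\,g$, if and only if $$[\vec X,f_1^{U_i}]=0\quad\text{on } \{(x,R)\in TM: x\in U_i,\ R\neq 0\}\quad\text{for every } i\in I.$$ -/

import Mathlib

open Bundle Set Filter Topology Manifold ContDiff

noncomputable section

namespace CurvatureRadii

section Flows

variable {E : Type*} [NormedAddCommGroup E] [NormedSpace ℝ E]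
  {H : Type*} [TopologicalSpace H] (I : ModelWithCorners ℝ E H)
  {M : Type*} [TopologicalSpace M] [ChartedSpace H M]

/-- `φ` is a (smooth) one-parameter group of diffeomorphisms of `M`, i.e. a smooth action of the
additive group `ℝ` on `M`. The inverse of `φ t` is `φ (-t)`. -/
structure IsOneParameterGroup (φ : ℝ → M → M) : Prop where
  contMDiff : ContMDiff (𝓘(ℝ, ℝ).prod I) I ∞ (fun q : ℝ × M => φ q.1 q.2)
  map_zero : ∀ x, φ 0 x = x
  map_add : ∀ s t x, φ (s + t) x = φ s (φ t x)

/-- The infinitesimal generator of a one-parameter group `φ`: the velocity at time `0` of the curve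
`t ↦ φ t x`. It is attached to the point `φ 0 x`, which is `x`. -/
def infinitesimalGenerator (φ : ℝ → M → M) (x : M) : TangentSpace I x :=
  (mfderiv 𝓘(ℝ, ℝ) I (fun t : ℝ => φ t x) 0 (1 : ℝ) : TangentSpace I (φ 0 x))

/-- A vector field is complete if it generates a global flow `(e^{tX})_{t ∈ ℝ}`. -/
def IsCompleteField (X : (x : M) → TangentSpace I x) : Prop :=
  ∃ φ : ℝ → M → M, IsOneParameterGroup I φ ∧ infinitesimalGenerator I φ = X

/-- The flow `e^{tX}` of a complete vector field. -/
def flow {X : (x : M) → TangentSpace I x} (hX : IsCompleteField I X) : ℝ → M → M :=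
  hX.choose

/-- The complete lift of `X` to `TM`: the infinitesimal generator of the one-parameter group
`(e^{tX})_*` of diffeomorphisms of `TM`. -/
def completeLift [IsManifold I 1 M] {X : (x : M) → TangentSpace I x}
    (hX : IsCompleteField I X) (p : TangentBundle I M) : TangentSpace I.tangent p :=
  infinitesimalGenerator I.tangent (fun t => tangentMap I I (flow I hX t)) p

end Flows

section Riemannian

variable {n : ℕ} {M : Type*} [TopologicalSpace M] [ChartedSpace (EuclideanSpace ℝ (Fin n)) M]

/-- The coordinate vector field `∂_i` of the chart at `x₀`, at the point with coordinates `y`. -/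
def coordField (x₀ : M) (i : Fin n) (y : EuclideanSpace ℝ (Fin n)) :
    TangentSpace (𝓡 n) ((extChartAt (𝓡 n) x₀).symm y) :=
  mfderiv 𝓘(ℝ, EuclideanSpace ℝ (Fin n)) (𝓡 n) (extChartAt (𝓡 n) x₀).symm y
    (EuclideanSpace.single i (1 : ℝ))

variable [IsManifold (𝓡 n) ∞ M] [RiemannianBundle (fun x : M => TangentSpace (𝓡 n) x)]

/-- The matrix `(g_{ij})` of the metric in the chart at `x₀`, at the point with coordinates `y`. -/
def metricMatrix (x₀ : M) (y : EuclideanSpace ℝ (Fin n)) : Matrix (Fin n) (Fin n) ℝ :=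
  Matrix.of fun i j => inner ℝ (coordField x₀ i y) (coordField x₀ j y)

/-- The partial derivative `∂_l g_{ij}` in the chart at `x₀`. -/
def metricPartial (x₀ : M) (l i j : Fin n) (y : EuclideanSpace ℝ (Fin n)) : ℝ :=
  fderiv ℝ (fun z => metricMatrix x₀ z i j) y (EuclideanSpace.single l (1 : ℝ))

/-- The Christoffel symbol `Γ^k_{ij} = (1/2) ∑_l g^{kl} (∂_i g_{jl} + ∂_j g_{il} - ∂_l g_{ij})`
of the Levi-Civita connection in the chart at `x₀`, at the point with coordinates `y`. -/
def christoffel (x₀ : M) (k i j : Fin n) (y : EuclideanSpace ℝ (Fin n)) : ℝ :=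
  (1 / 2) * ∑ l, (metricMatrix x₀ y)⁻¹ k l *
    (metricPartial x₀ i j l y + metricPartial x₀ j i l y - metricPartial x₀ l i j y)

/-- The `i`-th component of a tangent vector at `x` in the preferred chart at `x`: Mathlib identifies
`T_xM` with the model space through this chart. -/
def component {x : M} (u : TangentSpace (𝓡 n) x) (i : Fin n) : ℝ :=
  WithLp.ofLp (p := 2) (V := Fin n → ℝ) u i

/-- `Γ_x(u, v) = (∑_{i,j} Γ^k_{ij} u^i v^j)_k`, in the preferred chart at `x`, at `x` itself. -/
def christoffelAt (x : M) (u v : TangentSpace (𝓡 n) x) : TangentSpace (𝓡 n) x :=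
  WithLp.toLp (p := 2) (V := Fin n → ℝ) fun k =>
    ∑ i, ∑ j, christoffel x k i j (extChartAt (𝓡 n) x x) * component u i * component v j

/-- A homothety of `(M, g)`: a diffeomorphism `f` with `f^* g = c g` for a constant `c > 0`. -/
def IsHomothety (f : M → M) : Prop :=
  (∃ e : Diffeomorph (𝓡 n) (𝓡 n) M M ∞, ⇑e = f) ∧
    ∃ c : ℝ, 0 < c ∧ ∀ (x : M) (v w : TangentSpace (𝓡 n) x),
      inner ℝ (mfderiv (𝓡 n) (𝓡 n) f x v) (mfderiv (𝓡 n) (𝓡 n) f x w) = c * inner ℝ v w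

/-- `X` is the infinitesimal generator of a one-parameter group of homotheties of `(M, g)`. -/
def GeneratesHomotheties (X : (x : M) → TangentSpace (𝓡 n) x) : Prop :=
  ∃ φ : ℝ → M → M, IsOneParameterGroup (𝓡 n) φ ∧ infinitesimalGenerator (𝓡 n) φ = X ∧
    ∀ t, IsHomothety (n := n) (φ t)

end Riemannian

section Surface

variable {M : Type*} [TopologicalSpace M] [ChartedSpace (EuclideanSpace ℝ (Fin 2)) M]

instance (x : M) : Fact (Module.finrank ℝ (TangentSpace (𝓡 2) x) = 2) :=
  ⟨by
    have h : Module.finrank ℝ (EuclideanSpace ℝ (Fin 2)) = 2 := by simp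
    exact h⟩

variable [IsManifold (𝓡 2) ∞ M]

/-- `o` is an orientation of the open set `U` of the surface: the orientations `o x`, `x ∈ U`, are
given near every point of `U` by a continuous local frame. (Values of `o` outside `U` are
irrelevant.) -/
def IsOrientationOn (U : Set M) (o : (x : M) → Orientation ℝ (TangentSpace (𝓡 2) x) (Fin 2)) :
    Prop :=
  ∀ x₀ ∈ U, ∃ W ∈ 𝓝 x₀, ∃ b : (x : M) → Module.Basis (Fin 2) ℝ (TangentSpace (𝓡 2) x),
    (∀ i, ContinuousOn (fun x => (⟨x, b x i⟩ : TangentBundle (𝓡 2) M)) W) ∧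
      ∀ x ∈ W, (b x).orientation = o x

variable [RiemannianBundle (fun x : M => TangentSpace (𝓡 2) x)]

/-- `R^⊥`: the vector orthogonal to `R`, positively oriented with it and of the same length. -/
def perp (o : (x : M) → Orientation ℝ (TangentSpace (𝓡 2) x) (Fin 2)) (x : M)
    (R : TangentSpace (𝓡 2) x) : TangentSpace (𝓡 2) x :=
  (o x).rightAngleRotation R

/-- The vector field `f₁` on `TM`, whose integral curves `(x(t), R(t))` are the solutions of
`x' = R^⊥`, `D_t R = -R^⊥`. In the coordinates of `TM` induced by the preferred chart at `x`, in
which tangent vectors of `TM` at `(x, R)` are pairs `(x', R')`, one has `D_t R = R' + Γ(x', R)`, so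
that `f₁ = (R^⊥, -R^⊥ - Γ(R^⊥, R))`. -/
def f₁ (o : (x : M) → Orientation ℝ (TangentSpace (𝓡 2) x) (Fin 2))
    (p : TangentBundle (𝓡 2) M) : TangentSpace (𝓡 2).tangent p :=
  ((perp o p.1 p.2, -perp o p.1 p.2 - christoffelAt p.1 (perp o p.1 p.2) p.2) :
    EuclideanSpace ℝ (Fin 2) × EuclideanSpace ℝ (Fin 2))

end Surface

end CurvatureRadii

end

/-!
# Homotheties and the field `f₁`

The proof is infinitesimal and takes place in the coordinates `(y, r)` that a chart induces on the
tangent bundle. There the complete lift of `X` is `(X(y), ∂_r X(y))`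
(`IsOneParameterGroup.mfderiv_extChartAt_completeLift`), which is the symmetry of the mixed partial
derivatives of the flow, and `f₁` is `(J r, -J r - Γ(J r, r))`, where `J` is the rotation by a right
angle and `Γ` the Christoffel map (`mfderiv_extChartAt_f₁`). As `f₁` is defined at each point through
the preferred chart at that point, the latter rests on the transformation law of the Christoffel
symbols (`toCoord_christoffelAt`). It also needs `J` to be differentiable
(`differentiableAt_rotCoord`); this is where the continuity of the orientation enters.

The bracket is then an explicit expression (`lieBracket_completeLift`): its first component is
`(L_X J) r`, and when this vanishes the second one is `-(L_X Γ)(J r, r)`. The two conditions have the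
following meaning.

* In dimension two, `L_X J = 0` says that `X` is conformal, `L_X g = μ g` for a function `μ`
  (`exists_lieMetric_eq_of_lieEndo_eq_zero`, `lieEndo_eq_zero_of_lieMetric_eq`).
* If `L_X g = μ g`, then `L_X Γ` is the variation of the Levi-Civita connection under a conformal
  change of metric, `(L_X Γ)(u, v) = (dμ(u) v + dμ(v) u - g(u, v) ∇μ) / 2` (`metric_lieConnection`).
  As `g(J r, r) = 0`, the condition `(L_X Γ)(J r, r) = 0` reads `dμ(J r) r + dμ(r) J r = 0`; since `r`
  and `J r` are independent when `r ≠ 0`, it says that `dμ = 0` at the base point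
  (`IsRightAngleRotation.form_eq_zero`).

So the brackets vanish if and only if `L_X g = μ g` with `dμ = 0`, that is, with `μ` constant, as `M`
is connected. Finally the derivative of `|(e^{tX})_* v|²` at `t = 0` is `(L_X g)(v, v)`
(`IsOneParameterGroup.hasDerivAt_inner`). Hence for constant `μ` the flow satisfies
`(e^{tX})^* g = e^{μ t} g`, and conversely a flow of homotheties has a constant `μ`, the derivative at
`t = 0` of its scale factor (`IsConformalWith.generatesHomotheties`,
`GeneratesHomotheties.exists_isConformalWith`). The derivative of the squared length is a quantity
that does not involve charts, which makes `μ` a function on `M`.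
-/

namespace CurvatureRadii

-- Needed to find the norm on spaces of trilinear maps.
set_option maxSynthPendingDepth 3

/-! ### Lie derivatives in coordinates -/

section Coordinates

variable {E : Type*} [NormedAddCommGroup E] [NormedSpace ℝ E]

/-- The Lie derivative along `X` of a metric `G` on a vector space, evaluated on `u` and `v`:
`(L_X G)(u, v) = (∂_X G)(u, v) + G(∂_u X, v) + G(u, ∂_v X)`. -/
noncomputable def lieMetric (G : E → E →L[ℝ] E →L[ℝ] ℝ) (X : E → E) (y u v : E) : ℝ :=
  fderiv ℝ G y (X y) u v + G y (fderiv ℝ X y u) v + G y u (fderiv ℝ X y v)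

/-- The Lie derivative along `X` of a field of endomorphisms `J`, evaluated on `u`:
`(L_X J) u = (∂_X J) u + J (∂_u X) - ∂_{J u} X`. -/
noncomputable def lieEndo (J : E → E →L[ℝ] E) (X : E → E) (y u : E) : E :=
  fderiv ℝ J y (X y) u + J y (fderiv ℝ X y u) - fderiv ℝ X y (J y u)

/-- The Lie derivative along `X` of the connection with Christoffel map `Γ`, evaluated on `u` and
`v`. It is a tensor, although `Γ` is not one: the second derivative of `X` corrects for this. -/
noncomputable def lieConnection (Γ : E → E →L[ℝ] E →L[ℝ] E) (X : E → E) (y u v : E) : E :=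
  fderiv ℝ Γ y (X y) u v + Γ y (fderiv ℝ X y u) v + Γ y u (fderiv ℝ X y v)
    - fderiv ℝ X y (Γ y u v) + fderiv ℝ (fderiv ℝ X) y u v

/-- `Γ` satisfies the Koszul formula at `y`, which says that it is the Christoffel map of the
Levi-Civita connection of the metric `G` at that point. -/
def Koszul (G : E → E →L[ℝ] E →L[ℝ] ℝ) (Γ : E →L[ℝ] E →L[ℝ] E) (y : E) : Prop :=
  ∀ u v w, G y (Γ u v) w =
    (1 / 2) * (fderiv ℝ G y u v w + fderiv ℝ G y v u w - fderiv ℝ G y w u v)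

lemma lieMetric_symm {G : E → E →L[ℝ] E →L[ℝ] ℝ} {X : E → E} {y : E}
    (hG : DifferentiableAt ℝ G y) (hsymm : ∀ᶠ z in 𝓝 y, ∀ u v, G z u v = G z v u) (u v : E) :
    lieMetric G X y u v = lieMetric G X y v u := by
  have h := hsymm.self_of_nhds
  have hD : fderiv ℝ G y (X y) u v = fderiv ℝ G y (X y) v u := by
    have h1 : HasFDerivAt (fun z => G z u v) ((fderiv ℝ G y).flip u |>.flip v) y := by
      have := (hG.hasFDerivAt.clm_apply (hasFDerivAt_const u y)).clm_apply (hasFDerivAt_const v y)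
      convert! this using 1
      ext; simp
    have h2 : HasFDerivAt (fun z => G z u v) ((fderiv ℝ G y).flip v |>.flip u) y := by
      have := (hG.hasFDerivAt.clm_apply (hasFDerivAt_const v y)).clm_apply (hasFDerivAt_const u y)
      refine HasFDerivAt.congr_of_eventuallyEq ?_ (hsymm.mono fun z hz => hz u v)
      convert! this using 1
      ext; simp
    simpa using congrArg (fun L => L (X y)) (h1.unique h2)
  simp only [lieMetric]
  rw [hD, h _ v, h u]
  ring

/-- The derivative of a metric, applied to fixed vectors. -/
lemma hasFDerivAt_metric_apply {G : E → E →L[ℝ] E →L[ℝ] ℝ} {a b : E → E} {a' b' : E →L[ℝ] E}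
    {y : E} (hG : DifferentiableAt ℝ G y) (ha : HasFDerivAt a a' y) (hb : HasFDerivAt b b' y) :
    ∃ L : E →L[ℝ] ℝ, HasFDerivAt (fun z => G z (a z) (b z)) L y ∧
      ∀ w, L w = fderiv ℝ G y w (a y) (b y) + G y (a' w) (b y) + G y (a y) (b' w) := by
  refine ⟨_, (hG.hasFDerivAt.clm_apply ha).clm_apply hb, fun w => ?_⟩
  simp
  ring

/-- The identity `L_X G = μ G` near a point determines `L_X Γ` there: it is the variation of the
Levi-Civita connection under an infinitesimal conformal change of the metric. -/
lemma metric_lieConnection {G : E → E →L[ℝ] E →L[ℝ] ℝ} {Γ : E → E →L[ℝ] E →L[ℝ] E} {X : E → E}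
    {μ : E → ℝ} {y : E} (hG : ContDiffAt ℝ 2 G y) (hX : ContDiffAt ℝ 2 X y)
    (hΓ : DifferentiableAt ℝ Γ y) (hμ : DifferentiableAt ℝ μ y)
    (hsymm : ∀ᶠ z in 𝓝 y, ∀ u v, G z u v = G z v u)
    (hK : ∀ᶠ z in 𝓝 y, Koszul G (Γ z) z)
    (hS : ∀ᶠ z in 𝓝 y, ∀ u v, lieMetric G X z u v = μ z * G z u v) (u v w : E) :
    G y (lieConnection Γ X y u v) w =
      (1 / 2) * (fderiv ℝ μ y u * G y v w + fderiv ℝ μ y v * G y u w - fderiv ℝ μ y w * G y u v) := by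
  have hG1 : DifferentiableAt ℝ G y := hG.differentiableAt (by norm_num)
  have hX1 : DifferentiableAt ℝ X y := hX.differentiableAt (by norm_num)
  have hG2 : DifferentiableAt ℝ (fderiv ℝ G) y :=
    (hG.fderiv_right (m := 1) (by norm_num)).differentiableAt (by norm_num)
  have hX2 : DifferentiableAt ℝ (fderiv ℝ X) y :=
    (hX.fderiv_right (m := 1) (by norm_num)).differentiableAt (by norm_num)
  have sG : ∀ a b, fderiv ℝ (fderiv ℝ G) y a b = fderiv ℝ (fderiv ℝ G) y b a :=
    hG.isSymmSndFDerivAt (by simp)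
  have sX : ∀ a b, fderiv ℝ (fderiv ℝ X) y a b = fderiv ℝ (fderiv ℝ X) y b a :=
    hX.isSymmSndFDerivAt (by simp)
  have s0 := hsymm.self_of_nhds
  have s1 : ∀ a b c, fderiv ℝ G y a b c = fderiv ℝ G y a c b := by
    intro a b c
    obtain ⟨L, hL, hL'⟩ := hasFDerivAt_metric_apply hG1 (hasFDerivAt_const b y)
      (hasFDerivAt_const c y)
    obtain ⟨M, hM, hM'⟩ := hasFDerivAt_metric_apply hG1 (hasFDerivAt_const c y)
      (hasFDerivAt_const b y)
    have := hL.unique (hM.congr_of_eventuallyEq (hsymm.mono fun z hz => hz b c))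
    simpa [this, hM'] using (hL' a).symm
  -- the derivative of `L_X G = μ G` in the direction `a`
  have key : ∀ a b c, fderiv ℝ (fderiv ℝ G) y a (X y) b c + fderiv ℝ G y (fderiv ℝ X y a) b c
      + fderiv ℝ G y a (fderiv ℝ X y b) c + G y (fderiv ℝ (fderiv ℝ X) y a b) c
      + fderiv ℝ G y a b (fderiv ℝ X y c) + G y b (fderiv ℝ (fderiv ℝ X) y a c)
      = fderiv ℝ μ y a * G y b c + μ y * fderiv ℝ G y a b c := by
    intro a b c
    have hb : HasFDerivAt (fun z => fderiv ℝ X z b) ((fderiv ℝ (fderiv ℝ X) y).flip b) y := by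
      convert! hX2.hasFDerivAt.clm_apply (hasFDerivAt_const b y) using 1
      ext; simp
    have hc : HasFDerivAt (fun z => fderiv ℝ X z c) ((fderiv ℝ (fderiv ℝ X) y).flip c) y := by
      convert! hX2.hasFDerivAt.clm_apply (hasFDerivAt_const c y) using 1
      ext; simp
    obtain ⟨L1, hL1, hL1'⟩ := hasFDerivAt_metric_apply hG1 hb (hasFDerivAt_const c y)
    obtain ⟨L2, hL2, hL2'⟩ := hasFDerivAt_metric_apply hG1 (hasFDerivAt_const b y) hc
    obtain ⟨L4, hL4, hL4'⟩ := hasFDerivAt_metric_apply hG1 (hasFDerivAt_const b y)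
      (hasFDerivAt_const c y)
    have hL3 := ((hG2.hasFDerivAt.clm_apply hX1.hasFDerivAt).clm_apply
      (hasFDerivAt_const b y)).clm_apply (hasFDerivAt_const c y)
    have hL := (hL3.add hL1).add hL2
    have hR := hμ.hasFDerivAt.mul hL4
    have := hL.unique (hR.congr_of_eventuallyEq (hS.mono fun z hz => hz b c))
    have := congrArg (fun L => L a) this
    simp [hL1', hL2', hL4'] at this
    linarith
  have kos : G y (fderiv ℝ Γ y (X y) u v) w + fderiv ℝ G y (X y) (Γ y u v) w =
      (1 / 2) * (fderiv ℝ (fderiv ℝ G) y (X y) u v w + fderiv ℝ (fderiv ℝ G) y (X y) v u w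
        - fderiv ℝ (fderiv ℝ G) y (X y) w u v) := by
    have hb : HasFDerivAt (fun z => Γ z u v) (((fderiv ℝ Γ y).flip u).flip v) y := by
      convert! (hΓ.hasFDerivAt.clm_apply (hasFDerivAt_const u y)).clm_apply
        (hasFDerivAt_const v y) using 1
      ext; simp
    obtain ⟨L1, hL1, hL1'⟩ := hasFDerivAt_metric_apply hG1 hb (hasFDerivAt_const w y)
    have hd : ∀ a b c, HasFDerivAt (fun z => fderiv ℝ G z a b c)
        ((((fderiv ℝ (fderiv ℝ G) y).flip a).flip b).flip c) y := by
      intro a b c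
      convert! ((hG2.hasFDerivAt.clm_apply (hasFDerivAt_const a y)).clm_apply
        (hasFDerivAt_const b y)).clm_apply (hasFDerivAt_const c y) using 1
      ext; simp
    have hR := (((hd u v w).add (hd v u w)).sub (hd w u v)).const_mul (1 / 2 : ℝ)
    have := hL1.unique (hR.congr_of_eventuallyEq (hK.mono fun z hz => hz u v w))
    have := congrArg (fun L => L (X y)) this
    simp [hL1'] at this
    linarith
  have k0 := hK.self_of_nhds
  have S0 := hS.self_of_nhds (Γ y u v) w
  simp only [lieMetric] at S0
  simp only [lieConnection, map_add, map_sub, _root_.add_apply,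
    _root_.sub_apply]
  have k1 := k0 (fderiv ℝ X y u) v w
  have k2 := k0 u (fderiv ℝ X y v) w
  have k3 := k0 u v w
  have k4 := k0 u v (fderiv ℝ X y w)
  have e1 := key u v w
  have e2 := key v u w
  have e3 := key w u v
  rw [sG u] at e1
  rw [sG v] at e2
  rw [sG w] at e3
  rw [sX v u] at e2
  rw [sX w u, sX w v, s0 (fderiv ℝ (fderiv ℝ X) y u w) v] at e3
  rw [k3] at S0
  rw [k1, k2]
  rw [k4] at S0
  linarith

/-- The bracket, in coordinates of the tangent bundle, of the complete lift of `X` and of the field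
`(J r, -J r - Γ(J r, r))`. -/
lemma lieBracket_completeLift {X : E → E} {J : E → E →L[ℝ] E} {Γ : E → E →L[ℝ] E →L[ℝ] E} {y : E}
    (hX : ContDiffAt ℝ 2 X y) (hJ : DifferentiableAt ℝ J y) (hΓ : DifferentiableAt ℝ Γ y) (r : E) :
    VectorField.lieBracket ℝ (fun z : E × E => (X z.1, fderiv ℝ X z.1 z.2))
      (fun z : E × E => (J z.1 z.2, -J z.1 z.2 - Γ z.1 (J z.1 z.2) z.2)) (y, r) =
    (lieEndo J X y r, -lieEndo J X y r - Γ y (lieEndo J X y r) r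
      - lieConnection Γ X y (J y r) r) := by
  have hX1 : DifferentiableAt ℝ X y := hX.differentiableAt (by norm_num)
  have hX2 : DifferentiableAt ℝ (fderiv ℝ X) y :=
    (hX.fderiv_right (m := 1) (by norm_num)).differentiableAt (by norm_num)
  have hf : HasFDerivAt (fun z : E × E => z.1) (ContinuousLinearMap.fst ℝ E E) (y, r) :=
    hasFDerivAt_fst
  have hs : HasFDerivAt (fun z : E × E => z.2) (ContinuousLinearMap.snd ℝ E E) (y, r) :=
    hasFDerivAt_snd
  have cX : HasFDerivAt (fun z : E × E => X z.1) _ (y, r) :=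
    HasFDerivAt.comp (y, r) (g := X) hX1.hasFDerivAt hf
  have cDX : HasFDerivAt (fun z : E × E => fderiv ℝ X z.1) _ (y, r) :=
    HasFDerivAt.comp (y, r) (g := fderiv ℝ X) hX2.hasFDerivAt hf
  have cJ : HasFDerivAt (fun z : E × E => J z.1) _ (y, r) :=
    HasFDerivAt.comp (y, r) (g := J) hJ.hasFDerivAt hf
  have cΓ : HasFDerivAt (fun z : E × E => Γ z.1) _ (y, r) :=
    HasFDerivAt.comp (y, r) (g := Γ) hΓ.hasFDerivAt hf
  have hV := cX.prodMk (cDX.clm_apply hs)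
  have hJr := cJ.clm_apply hs
  have hW : HasFDerivAt (fun z : E × E => (J z.1 z.2, -J z.1 z.2 - Γ z.1 (J z.1 z.2) z.2)) _ (y, r) :=
    hJr.prodMk (hJr.neg.sub ((cΓ.clm_apply hJr).clm_apply hs))
  rw [VectorField.lieBracket, hV.fderiv, hW.fderiv]
  ext
  · simp [lieEndo]; abel
  · simp [lieEndo, lieConnection]; abel

end Coordinates

/-! ### Conformal fields and rotations by a right angle -/

section ConformalCoordinates

variable {E : Type*} [NormedAddCommGroup E] [NormedSpace ℝ E]

/-- `G` is an inner product and `J` is a rotation by a right angle for it. -/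
structure IsRightAngleRotation (G : E →L[ℝ] E →L[ℝ] ℝ) (J : E →L[ℝ] E) : Prop where
  symm : ∀ u v, G u v = G v u
  pos : ∀ u, u ≠ 0 → 0 < G u u
  isometry : ∀ u v, G (J u) (J v) = G u v
  ortho : ∀ u, G (J u) u = 0

namespace IsRightAngleRotation

variable {G : E →L[ℝ] E →L[ℝ] ℝ} {J : E →L[ℝ] E}

lemma eq_zero_of_apply_self (h : IsRightAngleRotation G J) {u : E} (hu : G u u = 0) : u = 0 := by
  by_contra h0
  exact (h.pos u h0).ne' hu

lemma ortho_add (h : IsRightAngleRotation G J) (u v : E) : G (J u) v + G (J v) u = 0 := by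
  have h1 := h.ortho (u + v)
  have h2 := h.ortho u
  have h3 := h.ortho v
  simp only [map_add, _root_.add_apply] at h1
  linarith

lemma exists_eq_add (h : IsRightAngleRotation G J) (hE : Module.finrank ℝ E = 2) {u : E}
    (hu : u ≠ 0) (w : E) : ∃ a b : ℝ, w = a • u + b • J u := by
  have hli : LinearIndependent ℝ ![u, J u] := by
    rw [LinearIndependent.pair_iff]
    intro s t hst
    have hp := h.pos u hu
    have h1 := congrArg (fun x => G x u) hst
    have h2 := congrArg (fun x => G x (J u)) hst
    simp [h.ortho, h.isometry, h.symm u (J u)] at h1 h2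
    exact ⟨h1.resolve_right hp.ne', h2.resolve_right hp.ne'⟩
  have : FiniteDimensional ℝ E := Module.finite_of_finrank_pos (by omega)
  have hspan := hli.span_eq_top_of_card_eq_finrank' (by simp [hE])
  have hw : w ∈ Submodule.span ℝ (Set.range ![u, J u]) := hspan ▸ Submodule.mem_top
  rw [Matrix.range_cons_cons_empty, Submodule.mem_span_pair] at hw
  obtain ⟨a, b, hab⟩ := hw
  exact ⟨a, b, hab.symm⟩

end IsRightAngleRotation

variable {G : E → E →L[ℝ] E →L[ℝ] ℝ} {J : E → E →L[ℝ] E} {X : E → E} {y : E}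

/-- The Lie derivative of the identity `G(J u, J v) = G(u, v)`. -/
lemma lieMetric_isometry (hG : DifferentiableAt ℝ G y) (hJ : DifferentiableAt ℝ J y)
    (h : ∀ᶠ z in 𝓝 y, IsRightAngleRotation (G z) (J z)) (u v : E) :
    lieMetric G X y (J y u) (J y v) + G y (lieEndo J X y u) (J y v) + G y (J y u) (lieEndo J X y v)
      = lieMetric G X y u v := by
  have hd : ∀ a, HasFDerivAt (fun z => J z a) ((fderiv ℝ J y).flip a) y := fun a => by
    convert! hJ.hasFDerivAt.clm_apply (hasFDerivAt_const a y) using 1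
    ext; simp
  obtain ⟨L, hL, hL'⟩ := hasFDerivAt_metric_apply hG (hd u) (hd v)
  obtain ⟨M, hM, hM'⟩ := hasFDerivAt_metric_apply hG (hasFDerivAt_const u y) (hasFDerivAt_const v y)
  have e := hL.unique (hM.congr_of_eventuallyEq (h.mono fun z hz => hz.isometry u v))
  have e := congrArg (fun L => L (X y)) e
  have h0 := h.self_of_nhds
  have i1 := h0.isometry (fderiv ℝ X y u) v
  have i2 := h0.isometry u (fderiv ℝ X y v)
  simp [hL', hM'] at e
  simp only [lieMetric, lieEndo, map_add, map_sub, _root_.add_apply, _root_.sub_apply]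
  linarith

/-- The Lie derivative of the identity `G(J u, u) = 0`. -/
lemma lieMetric_ortho (hG : DifferentiableAt ℝ G y) (hJ : DifferentiableAt ℝ J y)
    (h : ∀ᶠ z in 𝓝 y, IsRightAngleRotation (G z) (J z)) (u : E) :
    lieMetric G X y (J y u) u + G y (lieEndo J X y u) u = 0 := by
  have hd : ∀ a, HasFDerivAt (fun z => J z a) ((fderiv ℝ J y).flip a) y := fun a => by
    convert! hJ.hasFDerivAt.clm_apply (hasFDerivAt_const a y) using 1
    ext; simp
  obtain ⟨L, hL, hL'⟩ := hasFDerivAt_metric_apply hG (hd u) (hasFDerivAt_const u y)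
  have e := hL.unique ((hasFDerivAt_const (0 : ℝ) y).congr_of_eventuallyEq
    (h.mono fun z hz => hz.ortho u))
  have e := congrArg (fun L => L (X y)) e
  have i1 := h.self_of_nhds.ortho_add u (fderiv ℝ X y u)
  simp [hL'] at e
  simp only [lieMetric, lieEndo, map_add, map_sub, _root_.add_apply, _root_.sub_apply]
  linarith

lemma lieMetric_add_smul (a b a' b' : ℝ) (u v u' v' : E) :
    lieMetric G X y (a • u + b • v) (a' • u' + b' • v') =
      a * a' * lieMetric G X y u u' + a * b' * lieMetric G X y u v' +
      b * a' * lieMetric G X y v u' + b * b' * lieMetric G X y v v' := by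
  simp [lieMetric]
  ring

lemma lieMetric_eq_of_self {μ : ℝ} (hG : DifferentiableAt ℝ G y)
    (hsymm : ∀ᶠ z in 𝓝 y, ∀ u v, G z u v = G z v u)
    (hS : ∀ u, lieMetric G X y u u = μ * G y u u) (u v : E) :
    lieMetric G X y u v = μ * G y u v := by
  have h := lieMetric_add_smul (G := G) (X := X) (y := y) 1 1 1 1 u v u v
  have h2 := hsymm.self_of_nhds u v
  simp only [one_smul, hS, lieMetric_symm hG hsymm v u] at h
  have h3 : G y (u + v) = G y u + G y v := map_add _ _ _
  rw [h3, _root_.add_apply, map_add, map_add, ← h2] at h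
  linarith

/-- In dimension two, a field that preserves the rotation by a right angle is conformal: `L_X G` is
then invariant under `J`, and the invariant symmetric forms are the multiples of `G`. -/
lemma exists_lieMetric_eq_of_lieEndo_eq_zero (hE : Module.finrank ℝ E = 2)
    (hG : DifferentiableAt ℝ G y) (hJ : DifferentiableAt ℝ J y)
    (h : ∀ᶠ z in 𝓝 y, IsRightAngleRotation (G z) (J z)) (hB : ∀ u, lieEndo J X y u = 0) :
    ∃ μ : ℝ, ∀ u v, lieMetric G X y u v = μ * G y u v := by
  have h0 := h.self_of_nhds
  obtain ⟨u, hu⟩ : ∃ u : E, u ≠ 0 := by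
    have : Nontrivial E := Module.nontrivial_of_finrank_pos (R := ℝ) (by omega)
    exact exists_ne 0
  have hs := lieMetric_symm (X := X) hG (h.mono fun z hz => hz.symm)
  have hi : ∀ u v, lieMetric G X y (J y u) (J y v) = lieMetric G X y u v := fun u v => by
    simpa [hB] using lieMetric_isometry (X := X) hG hJ h u v
  have ho : ∀ u, lieMetric G X y (J y u) u = 0 := fun u => by
    simpa [hB] using lieMetric_ortho (X := X) hG hJ h u
  refine ⟨lieMetric G X y u u / G y u u, fun v w => ?_⟩
  have hp := h0.pos u hu
  obtain ⟨a, b, rfl⟩ := h0.exists_eq_add hE hu v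
  obtain ⟨c, d, rfl⟩ := h0.exists_eq_add hE hu w
  rw [lieMetric_add_smul, hi, hs u (J y u), ho]
  simp [h0.ortho, h0.isometry, h0.symm u (J y u)]
  field_simp

/-- In dimension two, a conformal field preserves the rotation by a right angle. -/
lemma lieEndo_eq_zero_of_lieMetric_eq (hE : Module.finrank ℝ E = 2)
    (hG : DifferentiableAt ℝ G y) (hJ : DifferentiableAt ℝ J y)
    (h : ∀ᶠ z in 𝓝 y, IsRightAngleRotation (G z) (J z)) {μ : ℝ}
    (hS : ∀ u v, lieMetric G X y u v = μ * G y u v) (u : E) : lieEndo J X y u = 0 := by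
  have h0 := h.self_of_nhds
  rcases eq_or_ne u 0 with rfl | hu
  · simp [lieEndo]
  have h1 := lieMetric_isometry (X := X) hG hJ h u u
  have h2 := lieMetric_ortho (X := X) hG hJ h u
  rw [hS, h0.ortho] at h2
  rw [hS, hS, h0.isometry, h0.symm (J y u)] at h1
  obtain ⟨a, b, hab⟩ := h0.exists_eq_add hE hu (lieEndo J X y u)
  refine h0.eq_zero_of_apply_self ?_
  nth_rewrite 2 [hab]
  simp only [map_add, map_smul, smul_eq_mul]
  rw [show G y (lieEndo J X y u) u = 0 by linarith,
    show G y (lieEndo J X y u) (J y u) = 0 by linarith]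
  simp

/-- If a linear form `δ` satisfies `δ(J r) r + δ(r) J r = 0`, which is what remains of
`(L_X Γ)(J r, r) = 0` for a conformal field with `d μ = δ`, then `δ = 0`. -/
lemma IsRightAngleRotation.form_eq_zero {G : E →L[ℝ] E →L[ℝ] ℝ} {J : E →L[ℝ] E}
    (h : IsRightAngleRotation G J) (hE : Module.finrank ℝ E = 2) {δ : E →L[ℝ] ℝ} {r : E}
    (hr : r ≠ 0) (hδ : ∀ w, δ (J r) * G r w + δ r * G (J r) w - δ w * G (J r) r = 0) : δ = 0 := by
  have hp := h.pos r hr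
  have h1 := hδ r
  have h2 := hδ (J r)
  rw [h.ortho] at h1 h2
  rw [h.isometry, h.symm r, h.ortho] at h2
  simp [hp.ne'] at h1 h2
  ext w
  obtain ⟨a, b, rfl⟩ := h.exists_eq_add hE hr w
  simp [h1, h2]

end ConformalCoordinates

/-! ### Change of coordinates of a connection -/

section ChangeOfCoordinates

variable {E : Type*} [NormedAddCommGroup E] [NormedSpace ℝ E]

/-- The transformation law of the Christoffel map under a change of coordinates `τ`. -/
lemma Koszul.map {G₁ G₂ : E → E →L[ℝ] E →L[ℝ] ℝ} {Γ₁ Γ₂ : E →L[ℝ] E →L[ℝ] E} {τ : E → E} {y : E}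
    (hτ : ContDiffAt ℝ 2 τ y) (hG₂ : DifferentiableAt ℝ G₂ (τ y))
    (hG : ∀ᶠ z in 𝓝 y, ∀ u v, G₁ z u v = G₂ (τ z) (fderiv ℝ τ z u) (fderiv ℝ τ z v))
    (hsurj : Function.Surjective (fderiv ℝ τ y)) (hsymm : ∀ u v, G₂ (τ y) u v = G₂ (τ y) v u)
    (hpos : ∀ u, u ≠ 0 → 0 < G₂ (τ y) u u) (hG₁ : DifferentiableAt ℝ G₁ y)
    (h₁ : Koszul G₁ Γ₁ y) (h₂ : Koszul G₂ Γ₂ (τ y)) (u v : E) :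
    fderiv ℝ τ y (Γ₁ u v) =
      Γ₂ (fderiv ℝ τ y u) (fderiv ℝ τ y v) + fderiv ℝ (fderiv ℝ τ) y u v := by
  have hτ1 : DifferentiableAt ℝ τ y := hτ.differentiableAt (by norm_num)
  have hτ2 : DifferentiableAt ℝ (fderiv ℝ τ) y :=
    (hτ.fderiv_right (m := 1) (by norm_num)).differentiableAt (by norm_num)
  have sτ : ∀ a b, fderiv ℝ (fderiv ℝ τ) y a b = fderiv ℝ (fderiv ℝ τ) y b a :=
    hτ.isSymmSndFDerivAt (by simp)
  have key : ∀ a b c, fderiv ℝ G₁ y a b c =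
      fderiv ℝ G₂ (τ y) (fderiv ℝ τ y a) (fderiv ℝ τ y b) (fderiv ℝ τ y c)
        + G₂ (τ y) (fderiv ℝ (fderiv ℝ τ) y a b) (fderiv ℝ τ y c)
        + G₂ (τ y) (fderiv ℝ τ y b) (fderiv ℝ (fderiv ℝ τ) y a c) := by
    intro a b c
    have hd : ∀ b, HasFDerivAt (fun z => fderiv ℝ τ z b) ((fderiv ℝ (fderiv ℝ τ) y).flip b) y := by
      intro b
      convert! hτ2.hasFDerivAt.clm_apply (hasFDerivAt_const b y) using 1
      ext; simp
    have hL := ((hG₂.hasFDerivAt.comp y hτ1.hasFDerivAt).clm_apply (hd b)).clm_apply (hd c)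
    obtain ⟨M, hM, hM'⟩ := hasFDerivAt_metric_apply hG₁ (hasFDerivAt_const b y)
      (hasFDerivAt_const c y)
    have e := hM.unique (hL.congr_of_eventuallyEq (hG.mono fun z hz => hz b c))
    have e := congrArg (fun L => L a) e
    simp [hM'] at e
    linarith
  obtain ⟨w, hw⟩ := hsurj (fderiv ℝ τ y (Γ₁ u v) -
      (Γ₂ (fderiv ℝ τ y u) (fderiv ℝ τ y v) + fderiv ℝ (fderiv ℝ τ) y u v))
  by_contra hne
  have hp := hpos _ (sub_ne_zero.2 hne)
  have e1 := h₁ u v w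
  rw [hG.self_of_nhds, key, key, key] at e1
  have e2 := h₂ (fderiv ℝ τ y u) (fderiv ℝ τ y v) (fderiv ℝ τ y w)
  rw [sτ v u, sτ w u, sτ w v, hsymm (fderiv ℝ (fderiv ℝ τ) y u w)] at e1
  rw [← hw] at hp
  nth_rewrite 1 [hw] at hp
  simp only [map_add, map_sub, _root_.add_apply, _root_.sub_apply] at hp
  linarith

end ChangeOfCoordinates

/-! ### Charts of the tangent bundle -/

section Charts

variable {n : ℕ} {M : Type*} [TopologicalSpace M] [ChartedSpace (EuclideanSpace ℝ (Fin n)) M]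

/-- The coordinates of a tangent vector at `x` in the chart at `x₀`. -/
noncomputable def toCoord (x₀ x : M) : TangentSpace (𝓡 n) x →L[ℝ] EuclideanSpace ℝ (Fin n) :=
  mfderiv (𝓡 n) 𝓘(ℝ, EuclideanSpace ℝ (Fin n)) (extChartAt (𝓡 n) x₀) x

/-- The tangent vector with given coordinates in the chart at `x₀`, at the point with
coordinates `y`. -/
noncomputable def ofCoord (x₀ : M) (y : EuclideanSpace ℝ (Fin n)) :
    EuclideanSpace ℝ (Fin n) →L[ℝ] TangentSpace (𝓡 n) ((extChartAt (𝓡 n) x₀).symm y) :=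
  mfderiv 𝓘(ℝ, EuclideanSpace ℝ (Fin n)) (𝓡 n) (extChartAt (𝓡 n) x₀).symm y

variable [IsManifold (𝓡 n) ∞ M]

lemma mdifferentiableAt_chart_symm {x₀ : M} {y : EuclideanSpace ℝ (Fin n)}
    (hy : y ∈ (extChartAt (𝓡 n) x₀).target) :
    MDifferentiableAt 𝓘(ℝ, EuclideanSpace ℝ (Fin n)) (𝓡 n) (extChartAt (𝓡 n) x₀).symm y := by
  have h := mdifferentiableWithinAt_extChartAt_symm hy
  rwa [ModelWithCorners.range_eq_univ, mdifferentiableWithinAt_univ] at h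

lemma mdifferentiableAt_chart {x₀ x : M} (hx : x ∈ (extChartAt (𝓡 n) x₀).source) :
    MDifferentiableAt (𝓡 n) 𝓘(ℝ, EuclideanSpace ℝ (Fin n)) (extChartAt (𝓡 n) x₀) x := by
  exact mdifferentiableAt_extChartAt (by rwa [← extChartAt_source (𝓡 n)])

lemma toCoord_ofCoord {x₀ : M} {y : EuclideanSpace ℝ (Fin n)}
    (hy : y ∈ (extChartAt (𝓡 n) x₀).target) (u : EuclideanSpace ℝ (Fin n)) :
    toCoord x₀ ((extChartAt (𝓡 n) x₀).symm y) (ofCoord x₀ y u) = u := by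
  have h := mfderiv_extChartAt_comp_mfderivWithin_extChartAt_symm hy
  rw [ModelWithCorners.range_eq_univ, mfderivWithin_univ] at h
  exact congrArg (fun L => L u) h

lemma ofCoord_toCoord {x₀ : M} {y : EuclideanSpace ℝ (Fin n)}
    (hy : y ∈ (extChartAt (𝓡 n) x₀).target)
    (v : TangentSpace (𝓡 n) ((extChartAt (𝓡 n) x₀).symm y)) :
    ofCoord x₀ y (toCoord x₀ ((extChartAt (𝓡 n) x₀).symm y) v) = v := by
  have h := mfderivWithin_extChartAt_symm_comp_mfderiv_extChartAt hy
  rw [ModelWithCorners.range_eq_univ, mfderivWithin_univ] at h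
  exact congrArg (fun L => L v) h

lemma toCoord_self (x : M) (v : TangentSpace (𝓡 n) x) : toCoord x x v = v := by
  exact congrArg (fun L => L v) (mfderiv_extChartAt_self (I := 𝓡 n) (x := x))

lemma trivializationAt_snd {x₀ : M} {p : TangentBundle (𝓡 n) M}
    (hp : p.1 ∈ (extChartAt (𝓡 n) x₀).source) :
    (trivializationAt (EuclideanSpace ℝ (Fin n)) (TangentSpace (𝓡 n)) x₀ p).2 =
      toCoord x₀ p.1 p.2 := by
  have hp' : p.1 ∈ (chartAt (EuclideanSpace ℝ (Fin n)) x₀).source := by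
    rwa [← extChartAt_source (𝓡 n)]
  have h := TangentBundle.continuousLinearMapAt_trivializationAt (I := 𝓡 n) (𝕜 := ℝ) hp'
  have h2 := congrArg (fun L => L p.2) h
  refine Eq.trans ?_ h2
  rw [Trivialization.continuousLinearMapAt_apply, Trivialization.linearMapAt_apply,
    TangentBundle.trivializationAt_baseSet, if_pos hp']

lemma extChartAt_tangent {p q : TangentBundle (𝓡 n) M}
    (hq : q.1 ∈ (extChartAt (𝓡 n) p.1).source) :
    extChartAt (𝓡 n).tangent p q = (extChartAt (𝓡 n) p.1 q.1, toCoord p.1 q.1 q.2) := by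
  rw [← trivializationAt_snd hq]
  have h := FiberBundle.extChartAt (IB := 𝓡 n) p
  exact congrArg (fun e : PartialEquiv _ _ => e q) h

lemma extChartAt_tangent_source (p : TangentBundle (𝓡 n) M) :
    (extChartAt (𝓡 n).tangent p).source = {q | q.1 ∈ (extChartAt (𝓡 n) p.1).source} := by
  ext q
  rw [extChartAt_source, extChartAt_source]
  exact TangentBundle.mem_chart_source_iff q p

lemma extChartAt_tangent_symm {p : TangentBundle (𝓡 n) M} {y : EuclideanSpace ℝ (Fin n)}
    (hy : y ∈ (extChartAt (𝓡 n) p.1).target) (r : EuclideanSpace ℝ (Fin n)) :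
    (extChartAt (𝓡 n).tangent p).symm (y, r) = ⟨(extChartAt (𝓡 n) p.1).symm y, ofCoord p.1 y r⟩ := by
  have hs := (extChartAt (𝓡 n) p.1).map_target hy
  have hq : (⟨(extChartAt (𝓡 n) p.1).symm y, ofCoord p.1 y r⟩ : TangentBundle (𝓡 n) M) ∈
      (extChartAt (𝓡 n).tangent p).source := by
    rw [extChartAt_tangent_source]; exact hs
  rw [← (extChartAt (𝓡 n).tangent p).left_inv hq, extChartAt_tangent (by exact hs)]
  congr 1
  exact Prod.ext ((extChartAt (𝓡 n) p.1).right_inv hy).symm (toCoord_ofCoord hy r).symm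

/-- The tangent vectors with fixed coordinates form a smooth local section. -/
lemma contMDiffAt_ofCoord {x₀ : M} {y : EuclideanSpace ℝ (Fin n)}
    (hy : y ∈ (extChartAt (𝓡 n) x₀).target) (u : EuclideanSpace ℝ (Fin n)) :
    ContMDiffAt 𝓘(ℝ, EuclideanSpace ℝ (Fin n)) (𝓡 n).tangent ∞
      (fun z => (⟨(extChartAt (𝓡 n) x₀).symm z, ofCoord x₀ z u⟩ : TangentBundle (𝓡 n) M)) y := by
  have hs := (extChartAt (𝓡 n) x₀).map_target hy
  have ht : (extChartAt (𝓡 n) x₀).target ∈ 𝓝 y := (isOpen_extChartAt_target x₀).mem_nhds hy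
  rw [(trivializationAt (EuclideanSpace ℝ (Fin n)) (TangentSpace (𝓡 n)) x₀).contMDiffAt_iff
    (by rw [TangentBundle.trivializationAt_source]; rwa [extChartAt_source] at hs)]
  refine ⟨(contMDiffOn_extChartAt_symm x₀).contMDiffAt ht, ?_⟩
  refine contMDiffAt_const (c := u) |>.congr_of_eventuallyEq ?_
  filter_upwards [ht] with z hz
  rw [trivializationAt_snd ((extChartAt (𝓡 n) x₀).map_target hz)]
  exact toCoord_ofCoord hz u

/-- The coordinates of a vector field in the chart at `x₀`. -/
noncomputable def fieldCoord (X : (x : M) → TangentSpace (𝓡 n) x) (x₀ : M)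
    (y : EuclideanSpace ℝ (Fin n)) : EuclideanSpace ℝ (Fin n) :=
  toCoord x₀ ((extChartAt (𝓡 n) x₀).symm y) (X ((extChartAt (𝓡 n) x₀).symm y))

lemma contDiffAt_fieldCoord {X : (x : M) → TangentSpace (𝓡 n) x}
    (hX : ContMDiff (𝓡 n) (𝓡 n).tangent ∞ (fun x => (⟨x, X x⟩ : TangentBundle (𝓡 n) M)))
    {x₀ : M} {y : EuclideanSpace ℝ (Fin n)} (hy : y ∈ (extChartAt (𝓡 n) x₀).target) :
    ContDiffAt ℝ ∞ (fieldCoord X x₀) y := by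
  have hs := (extChartAt (𝓡 n) x₀).map_target hy
  have ht : (extChartAt (𝓡 n) x₀).target ∈ 𝓝 y := (isOpen_extChartAt_target x₀).mem_nhds hy
  have h := (hX ((extChartAt (𝓡 n) x₀).symm y)).comp y
    ((contMDiffOn_extChartAt_symm x₀).contMDiffAt ht)
  rw [(trivializationAt (EuclideanSpace ℝ (Fin n)) (TangentSpace (𝓡 n)) x₀).contMDiffAt_iff
    (by rw [TangentBundle.trivializationAt_source]; rwa [extChartAt_source] at hs)] at h
  refine h.2.contDiffAt.congr_of_eventuallyEq ?_
  filter_upwards [ht] with z hz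
  exact (trivializationAt_snd
    (p := ⟨(extChartAt (𝓡 n) x₀).symm z, X ((extChartAt (𝓡 n) x₀).symm z)⟩)
    ((extChartAt (𝓡 n) x₀).map_target hz)).symm

end Charts

/-! ### The linearization of a flow -/

section FlowCalculus

variable {E : Type*} [NormedAddCommGroup E] [NormedSpace ℝ E]

/-- The linearization of a flow is generated by the linearization of its generator. This is the
symmetry of the mixed partial derivatives of the flow. -/
lemma hasDerivAt_fderiv_flow {Φ : ℝ × E → E} {X : E → E} {y : E} (hΦ : ContDiffAt ℝ 2 Φ (0, y))
    (hX : ∀ᶠ z in 𝓝 y, HasDerivAt (fun t => Φ (t, z)) (X z) 0) (r : E) :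
    HasDerivAt (fun t => fderiv ℝ (fun z => Φ (t, z)) y r) (fderiv ℝ X y r) 0 := by
  have hd : ∀ᶠ q in 𝓝 ((0 : ℝ), y), DifferentiableAt ℝ Φ q :=
    (hΦ.eventually (by simp)).mono fun q hq => hq.differentiableAt (by norm_num)
  have h2 : HasFDerivAt (fderiv ℝ Φ) (fderiv ℝ (fderiv ℝ Φ) (0, y)) (0, y) :=
    ((hΦ.fderiv_right (m := 1) (by norm_num)).differentiableAt (by norm_num)).hasFDerivAt
  have ht : Tendsto (fun t : ℝ => (t, y)) (𝓝 0) (𝓝 (0, y)) := by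
    apply Continuous.tendsto' (by fun_prop); rfl
  have hz : Tendsto (fun z : E => ((0 : ℝ), z)) (𝓝 y) (𝓝 (0, y)) := by
    apply Continuous.tendsto' (by fun_prop); rfl
  have e1 : ∀ᶠ t in 𝓝 (0 : ℝ), fderiv ℝ (fun z => Φ (t, z)) y r = fderiv ℝ Φ (t, y) (0, r) := by
    filter_upwards [ht.eventually hd] with t h
    have := HasFDerivAt.comp (f := fun z : E => (t, z)) y h.hasFDerivAt (hasFDerivAt_prodMk_right t y)
    rw [show (fun z => Φ (t, z)) = Φ ∘ fun z => (t, z) from rfl, this.fderiv]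
    simp
  have e2 : ∀ᶠ z in 𝓝 y, X z = fderiv ℝ Φ (0, z) (1, 0) := by
    filter_upwards [hz.eventually hd, hX] with z h h'
    have := HasFDerivAt.comp (f := fun t : ℝ => (t, z)) 0 h.hasFDerivAt
      (hasFDerivAt_prodMk_left (0 : ℝ) z)
    rw [h'.unique this.hasDerivAt]
    simp
  have d1 : HasDerivAt (fun t => fderiv ℝ Φ (t, y) (0, r))
      (fderiv ℝ (fderiv ℝ Φ) (0, y) (1, 0) (0, r)) 0 := by
    have := (HasFDerivAt.comp (f := fun t : ℝ => (t, y)) 0 h2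
      (hasFDerivAt_prodMk_left (0 : ℝ) y)).clm_apply (hasFDerivAt_const ((0 : ℝ), r) (0 : ℝ))
    convert! this.hasDerivAt using 1
    simp
  have d2 : HasFDerivAt (fun z => fderiv ℝ Φ (0, z) (1, 0)) _ y :=
    (HasFDerivAt.comp (f := fun z : E => ((0 : ℝ), z)) y h2
      (hasFDerivAt_prodMk_right (0 : ℝ) y)).clm_apply (hasFDerivAt_const ((1 : ℝ), (0 : E)) y)
  have e3 : fderiv ℝ X y r = fderiv ℝ (fderiv ℝ Φ) (0, y) (0, r) (1, 0) := by
    rw [(d2.congr_of_eventuallyEq e2).fderiv]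
    simp
  rw [e3, ← (hΦ.isSymmSndFDerivAt (by simp)) (1, 0) (0, r)]
  exact d1.congr_of_eventuallyEq e1

end FlowCalculus

/-! ### The Lie bracket in a chart -/

section LieBracketChart

variable {E : Type*} [NormedAddCommGroup E] [NormedSpace ℝ E] {H : Type*} [TopologicalSpace H]
  {I : ModelWithCorners ℝ E H} [I.Boundaryless] {N : Type*} [TopologicalSpace N]
  [ChartedSpace H N] [IsManifold I 1 N]

/-- The Lie bracket may be computed in the chart at the point. -/
lemma mlieBracket_eq_zero_iff (V W : (q : N) → TangentSpace I q) (p : N) {V' W' : E → E}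
    (hV : ∀ᶠ z in 𝓝 (extChartAt I p p), V' z =
      mfderiv I 𝓘(ℝ, E) (extChartAt I p) ((extChartAt I p).symm z) (V ((extChartAt I p).symm z)))
    (hW : ∀ᶠ z in 𝓝 (extChartAt I p p), W' z =
      mfderiv I 𝓘(ℝ, E) (extChartAt I p) ((extChartAt I p).symm z) (W ((extChartAt I p).symm z))) :
    VectorField.mlieBracket I V W p = 0 ↔
      VectorField.lieBracket ℝ V' W' (extChartAt I p p) = 0 := by
  have ht : (extChartAt I p).target ∈ 𝓝 (extChartAt I p p) := extChartAt_target_mem_nhds p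
  have key : ∀ (V : (q : N) → TangentSpace I q) (V' : E → E),
      (∀ᶠ z in 𝓝 (extChartAt I p p), V' z = mfderiv I 𝓘(ℝ, E) (extChartAt I p)
        ((extChartAt I p).symm z) (V ((extChartAt I p).symm z))) →
      VectorField.mpullbackWithin 𝓘(ℝ, E) I (extChartAt I p).symm V (range I)
        =ᶠ[𝓝 (extChartAt I p p)] V' := by
    intro V V' hV
    filter_upwards [hV, ht] with z hz hzt
    rw [hz, VectorField.mpullbackWithin_apply,
      ContinuousLinearMap.inverse_eq (mfderivWithin_extChartAt_symm_comp_mfderiv_extChartAt hzt)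
        (mfderiv_extChartAt_comp_mfderivWithin_extChartAt_symm hzt)]
    rfl
  rw [← VectorField.mlieBracketWithin_univ, VectorField.mlieBracketWithin_apply, preimage_univ,
    univ_inter]
  have hinv := isInvertible_mfderiv_extChartAt (I := I) (mem_extChartAt_source (I := I) p)
  obtain ⟨e, he⟩ := hinv
  rw [← he, ContinuousLinearMap.inverse_equiv]
  have e0 : VectorField.lieBracketWithin ℝ
      (VectorField.mpullbackWithin 𝓘(ℝ, E) I (extChartAt I p).symm V (range I))
      (VectorField.mpullbackWithin 𝓘(ℝ, E) I (extChartAt I p).symm W (range I)) (range I)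
      (extChartAt I p p) = VectorField.lieBracket ℝ V' W' (extChartAt I p p) := by
    have hu : ∀ (A B : E → E) (z : E), VectorField.lieBracketWithin ℝ A B (range I) z =
        VectorField.lieBracket ℝ A B z := fun A B z => by
      rw [ModelWithCorners.range_eq_univ, VectorField.lieBracketWithin_univ]
    refine (hu _ _ _).trans ?_
    exact Filter.EventuallyEq.lieBracket_vectorField_eq (key V V' hV) (key W W' hW)
  rw [e0]
  exact e.symm.map_eq_zero_iff

end LieBracketChart

/-! ### Generators and complete lifts in a chart -/

section GeneratorChart

variable {E : Type*} [NormedAddCommGroup E] [NormedSpace ℝ E] {H : Type*} [TopologicalSpace H]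
  {I : ModelWithCorners ℝ E H} [I.Boundaryless] {N : Type*} [TopologicalSpace N]
  [ChartedSpace H N] [IsManifold I 1 N]

/-- The infinitesimal generator may be computed in a chart. -/
lemma mfderiv_extChartAt_infinitesimalGenerator {φ : ℝ → N → N} {p q : N} {v : E}
    (h0 : φ 0 q = q) (hs : ∀ᶠ t in 𝓝 (0 : ℝ), φ t q ∈ (extChartAt I p).source)
    (hd : HasDerivAt (fun t => extChartAt I p (φ t q)) v 0) :
    mfderiv I 𝓘(ℝ, E) (extChartAt I p) q (infinitesimalGenerator I φ q) = v := by
  have hs0 : φ 0 q ∈ (extChartAt I p).source := hs.self_of_nhds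
  have hch : MDifferentiableAt I 𝓘(ℝ, E) (extChartAt I p) (φ 0 q) :=
    mdifferentiableAt_extChartAt (by rwa [← extChartAt_source I])
  have hsy : MDifferentiableAt 𝓘(ℝ, E) I (extChartAt I p).symm (extChartAt I p (φ 0 q)) := by
    have h := mdifferentiableWithinAt_extChartAt_symm ((extChartAt I p).map_source hs0)
    rwa [ModelWithCorners.range_eq_univ, mdifferentiableWithinAt_univ] at h
  have hγ : MDifferentiableAt 𝓘(ℝ, ℝ) I (fun t => φ t q) 0 := by
    refine (MDifferentiableAt.comp (I' := 𝓘(ℝ, E)) (0 : ℝ) (f := fun t => extChartAt I p (φ t q))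
      hsy hd.differentiableAt.mdifferentiableAt).congr_of_eventuallyEq ?_
    filter_upwards [hs] with t ht
    exact ((extChartAt I p).left_inv ht).symm
  have key := mfderiv_comp (I' := I) (0 : ℝ) hch hγ
  rw [mfderiv_eq_fderiv] at key
  have key2 : fderiv ℝ (fun t => extChartAt I p (φ t q)) 0 1 = mfderiv I 𝓘(ℝ, E) (extChartAt I p)
      (φ 0 q) (mfderiv 𝓘(ℝ, ℝ) I (fun t => φ t q) 0 (1 : ℝ)) := congrArg (fun L => L (1 : ℝ)) key
  rw [hd.hasFDerivAt.fderiv] at key2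
  have aux : ∀ q', q' = φ 0 q → ∀ w : E, (mfderiv I 𝓘(ℝ, E) (extChartAt I p) q' : E →L[ℝ] E) w =
      (mfderiv I 𝓘(ℝ, E) (extChartAt I p) (φ 0 q) : E →L[ℝ] E) w := by
    rintro _ rfl w; rfl
  refine (aux q h0.symm _).trans (key2.symm.trans ?_)
  simp

end GeneratorChart

section FlowChart

variable {n : ℕ} {M : Type*} [TopologicalSpace M] [ChartedSpace (EuclideanSpace ℝ (Fin n)) M]

/-- A flow in the chart at `x₀`, as a map of the time and of the coordinates. -/
noncomputable def flowCoord (φ : ℝ → M → M) (x₀ : M) (q : ℝ × EuclideanSpace ℝ (Fin n)) :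
    EuclideanSpace ℝ (Fin n) :=
  extChartAt (𝓡 n) x₀ (φ q.1 ((extChartAt (𝓡 n) x₀).symm q.2))

variable {φ : ℝ → M → M} {x₀ : M} {y : EuclideanSpace ℝ (Fin n)}

namespace IsOneParameterGroup

lemma contMDiff_apply (hφ : IsOneParameterGroup (𝓡 n) φ) (t : ℝ) :
    ContMDiff (𝓡 n) (𝓡 n) ∞ (φ t) :=
  hφ.contMDiff.comp (contMDiff_const.prodMk contMDiff_id)

lemma eventually_mem_source (hφ : IsOneParameterGroup (𝓡 n) φ)
    (hy : y ∈ (extChartAt (𝓡 n) x₀).target) :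
    ∀ᶠ t in 𝓝 (0 : ℝ), φ t ((extChartAt (𝓡 n) x₀).symm y) ∈ (extChartAt (𝓡 n) x₀).source := by
  have hs := (extChartAt (𝓡 n) x₀).map_target hy
  have hc : Continuous fun t => φ t ((extChartAt (𝓡 n) x₀).symm y) :=
    hφ.contMDiff.continuous.comp (by fun_prop : Continuous fun t : ℝ =>
      (t, (extChartAt (𝓡 n) x₀).symm y))
  refine hc.continuousAt.eventually_mem ((isOpen_extChartAt_source x₀).mem_nhds ?_)
  rwa [hφ.map_zero]

variable [IsManifold (𝓡 n) ∞ M]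

lemma contDiffAt_flowCoord (hφ : IsOneParameterGroup (𝓡 n) φ)
    (hy : y ∈ (extChartAt (𝓡 n) x₀).target) : ContDiffAt ℝ ∞ (flowCoord φ x₀) (0, y) := by
  have hs := (extChartAt (𝓡 n) x₀).map_target hy
  have ht : (extChartAt (𝓡 n) x₀).target ∈ 𝓝 y := (isOpen_extChartAt_target x₀).mem_nhds hy
  have h1 : ContMDiffAt 𝓘(ℝ, EuclideanSpace ℝ (Fin n)) (𝓡 n) ∞ (extChartAt (𝓡 n) x₀).symm y :=
    (contMDiffOn_extChartAt_symm x₀).contMDiffAt ht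
  have h2 : ContMDiffAt (𝓘(ℝ, ℝ).prod 𝓘(ℝ, EuclideanSpace ℝ (Fin n))) (𝓘(ℝ, ℝ).prod (𝓡 n)) ∞
      (fun q : ℝ × EuclideanSpace ℝ (Fin n) => (q.1, (extChartAt (𝓡 n) x₀).symm q.2)) (0, y) :=
    contMDiffAt_fst.prodMk (ContMDiffAt.comp (0, y) (by exact h1) contMDiffAt_snd)
  have h3 : ContMDiffAt (𝓡 n) 𝓘(ℝ, EuclideanSpace ℝ (Fin n)) ∞ (extChartAt (𝓡 n) x₀)
      (φ 0 ((extChartAt (𝓡 n) x₀).symm y)) := by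
    rw [hφ.map_zero]
    exact contMDiffAt_extChartAt' (by rwa [← extChartAt_source (𝓡 n)])
  have h4 := ContMDiffAt.comp ((0 : ℝ), y) (by exact h3) (ContMDiffAt.comp ((0 : ℝ), y)
    (hφ.contMDiff _) h2)
  rw [← modelWithCornersSelf_prod, chartedSpaceSelf_prod] at h4
  exact h4.contDiffAt

lemma hasDerivAt_flowCoord (hφ : IsOneParameterGroup (𝓡 n) φ)
    (hy : y ∈ (extChartAt (𝓡 n) x₀).target) :
    HasDerivAt (fun t => flowCoord φ x₀ (t, y))
      (fieldCoord (infinitesimalGenerator (𝓡 n) φ) x₀ y) 0 := by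
  have hd : DifferentiableAt ℝ (fun t => flowCoord φ x₀ (t, y)) 0 :=
    DifferentiableAt.comp (g := flowCoord φ x₀) (f := fun t : ℝ => (t, y)) 0
      ((hφ.contDiffAt_flowCoord hy).differentiableAt (by simp)) (by fun_prop)
  have h := mfderiv_extChartAt_infinitesimalGenerator (I := 𝓡 n) (hφ.map_zero _)
    (hφ.eventually_mem_source hy) hd.hasDerivAt
  rw [fieldCoord, toCoord]
  exact h ▸ hd.hasDerivAt

lemma toCoord_mfderiv (hφ : IsOneParameterGroup (𝓡 n) φ)
    (hy : y ∈ (extChartAt (𝓡 n) x₀).target) (r : EuclideanSpace ℝ (Fin n)) {t : ℝ}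
    (ht : φ t ((extChartAt (𝓡 n) x₀).symm y) ∈ (extChartAt (𝓡 n) x₀).source) :
    toCoord x₀ (φ t ((extChartAt (𝓡 n) x₀).symm y))
      (mfderiv (𝓡 n) (𝓡 n) (φ t) ((extChartAt (𝓡 n) x₀).symm y) (ofCoord x₀ y r)) =
    fderiv ℝ (fun z => flowCoord φ x₀ (t, z)) y r := by
  have h1 := mdifferentiableAt_chart_symm hy
  have h2 : MDifferentiableAt (𝓡 n) (𝓡 n) (φ t) ((extChartAt (𝓡 n) x₀).symm y) :=
    (hφ.contMDiff_apply t).mdifferentiable (by simp) _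
  have h3 := mdifferentiableAt_chart ht
  have k1 := mfderiv_comp y h2 h1
  have k2 := mfderiv_comp (I' := 𝓡 n) y (f := φ t ∘ (extChartAt (𝓡 n) x₀).symm) h3 (h2.comp y h1)
  rw [k1, mfderiv_eq_fderiv] at k2
  exact (congrArg (fun L => L r) k2).symm

/-- The linearized flow in coordinates. -/
lemma hasDerivAt_tangentMap (hφ : IsOneParameterGroup (𝓡 n) φ)
    (hy : y ∈ (extChartAt (𝓡 n) x₀).target) (r : EuclideanSpace ℝ (Fin n)) :
    HasDerivAt (fun t => fderiv ℝ (fun z => flowCoord φ x₀ (t, z)) y r)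
      (fderiv ℝ (fieldCoord (infinitesimalGenerator (𝓡 n) φ) x₀) y r) 0 :=
  hasDerivAt_fderiv_flow ((hφ.contDiffAt_flowCoord hy).of_le ENat.LEInfty.out)
    (((isOpen_extChartAt_target x₀).eventually_mem hy).mono
      fun _ hz => hφ.hasDerivAt_flowCoord hz) r

/-- The complete lift of a field `X` is `(X(y), ∂_r X(y))` in coordinates `(y, r)`. -/
lemma mfderiv_extChartAt_completeLift (hφ : IsOneParameterGroup (𝓡 n) φ)
    {p : TangentBundle (𝓡 n) M} (hy : y ∈ (extChartAt (𝓡 n) p.1).target)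
    (r : EuclideanSpace ℝ (Fin n)) :
    mfderiv (𝓡 n).tangent 𝓘(ℝ, EuclideanSpace ℝ (Fin n) × EuclideanSpace ℝ (Fin n))
      (extChartAt (𝓡 n).tangent p) ⟨(extChartAt (𝓡 n) p.1).symm y, ofCoord p.1 y r⟩
      (infinitesimalGenerator (𝓡 n).tangent (fun t => tangentMap (𝓡 n) (𝓡 n) (φ t))
        ⟨(extChartAt (𝓡 n) p.1).symm y, ofCoord p.1 y r⟩) =
    (fieldCoord (infinitesimalGenerator (𝓡 n) φ) p.1 y,
      fderiv ℝ (fieldCoord (infinitesimalGenerator (𝓡 n) φ) p.1) y r) := by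
  refine mfderiv_extChartAt_infinitesimalGenerator ?_ ?_ ?_
  · have : φ 0 = id := funext hφ.map_zero
    simp only [this, tangentMap_id, id]
  · filter_upwards [hφ.eventually_mem_source hy] with t ht
    rw [extChartAt_tangent_source]
    exact ht
  · refine ((hφ.hasDerivAt_flowCoord hy).prodMk
      (hφ.hasDerivAt_tangentMap hy r)).congr_of_eventuallyEq ?_
    filter_upwards [hφ.eventually_mem_source hy] with t ht
    rw [extChartAt_tangent (by exact ht)]
    exact Prod.ext rfl (hφ.toCoord_mfderiv hy r ht)

end IsOneParameterGroup

end FlowChart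

/-! ### The metric and its Christoffel symbols in a chart -/

section MetricChart

variable {n : ℕ}

lemma sum_smul_single (v : EuclideanSpace ℝ (Fin n)) :
    ∑ i, v i • EuclideanSpace.single i (1 : ℝ) = v := by
  ext j
  simp [Finset.sum_apply, Pi.single_apply]

lemma euclideanSpace_induction {P : EuclideanSpace ℝ (Fin n) → Prop} (h0 : P 0)
    (hadd : ∀ u v, P u → P v → P (u + v)) (hsmul : ∀ (a : ℝ) u, P u → P (a • u))
    (h : ∀ i, P (EuclideanSpace.single i 1)) (v : EuclideanSpace ℝ (Fin n)) : P v := by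
  rw [← sum_smul_single v]
  exact Finset.sum_induction _ P hadd h0 fun i _ => hsmul _ _ (h i)

variable {M : Type*} [TopologicalSpace M] [ChartedSpace (EuclideanSpace ℝ (Fin n)) M]
  [RiemannianBundle (fun x : M => TangentSpace (𝓡 n) x)]

/-- The metric in the chart at `x₀`, at the point with coordinates `y`. -/
noncomputable def metricCoord (x₀ : M) (y : EuclideanSpace ℝ (Fin n)) :
    EuclideanSpace ℝ (Fin n) →L[ℝ] EuclideanSpace ℝ (Fin n) →L[ℝ] ℝ :=
  (innerSL ℝ (E := TangentSpace (𝓡 n) ((extChartAt (𝓡 n) x₀).symm y))).bilinearComp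
    (ofCoord x₀ y) (ofCoord x₀ y)

lemma metricCoord_apply (x₀ : M) (y u v : EuclideanSpace ℝ (Fin n)) :
    metricCoord x₀ y u v = inner ℝ (ofCoord x₀ y u) (ofCoord x₀ y v) := rfl

lemma metricCoord_symm (x₀ : M) (y u v : EuclideanSpace ℝ (Fin n)) :
    metricCoord x₀ y u v = metricCoord x₀ y v u := by
  rw [metricCoord_apply, metricCoord_apply, real_inner_comm]

lemma metricMatrix_apply (x₀ : M) (y : EuclideanSpace ℝ (Fin n)) (i j : Fin n) :
    metricMatrix x₀ y i j = metricCoord x₀ y (EuclideanSpace.single i 1)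
      (EuclideanSpace.single j 1) := rfl

/-- The Christoffel symbols of the chart at `x₀`, as a bilinear map. -/
noncomputable def christoffelCoord (x₀ : M) (y : EuclideanSpace ℝ (Fin n)) :
    EuclideanSpace ℝ (Fin n) →L[ℝ] EuclideanSpace ℝ (Fin n) →L[ℝ] EuclideanSpace ℝ (Fin n) :=
  ∑ i, ∑ j, (EuclideanSpace.proj i : EuclideanSpace ℝ (Fin n) →L[ℝ] ℝ).smulRight
    ((EuclideanSpace.proj j : EuclideanSpace ℝ (Fin n) →L[ℝ] ℝ).smulRight
      (WithLp.toLp 2 fun k => christoffel x₀ k i j y))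

lemma christoffelCoord_apply (x₀ : M) (y u v : EuclideanSpace ℝ (Fin n)) :
    christoffelCoord x₀ y u v =
      WithLp.toLp 2 fun k => ∑ i, ∑ j, christoffel x₀ k i j y * u i * v j := by
  ext k
  simp [christoffelCoord, Finset.sum_apply, _root_.sum_apply]
  refine Finset.sum_congr rfl fun i _ => Finset.sum_congr rfl fun j _ => ?_
  ring

lemma christoffelAt_eq (x : M) (u v : TangentSpace (𝓡 n) x) :
    christoffelAt x u v = christoffelCoord x (extChartAt (𝓡 n) x x) u v :=
  (christoffelCoord_apply x (extChartAt (𝓡 n) x x) u v).symm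

lemma christoffelCoord_single (x₀ : M) (y : EuclideanSpace ℝ (Fin n)) (i j : Fin n) :
    christoffelCoord x₀ y (EuclideanSpace.single i 1) (EuclideanSpace.single j 1) =
      ∑ k, christoffel x₀ k i j y • EuclideanSpace.single k (1 : ℝ) := by
  rw [← sum_smul_single (christoffelCoord x₀ y _ _), christoffelCoord_apply]
  simp

variable [IsManifold (𝓡 n) ∞ M]

lemma metricCoord_pos {x₀ : M} {y : EuclideanSpace ℝ (Fin n)}
    (hy : y ∈ (extChartAt (𝓡 n) x₀).target) {u : EuclideanSpace ℝ (Fin n)} (hu : u ≠ 0) :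
    0 < metricCoord x₀ y u u := by
  rw [metricCoord_apply]
  refine real_inner_self_pos.2 fun h => hu ?_
  rw [← toCoord_ofCoord hy u, h, map_zero]

lemma metricCoord_toCoord {x₀ x : M} (hx : x ∈ (extChartAt (𝓡 n) x₀).source)
    (v w : TangentSpace (𝓡 n) x) :
    metricCoord x₀ (extChartAt (𝓡 n) x₀ x) (toCoord x₀ x v) (toCoord x₀ x w) = inner ℝ v w := by
  obtain ⟨y, hy, rfl⟩ : ∃ y ∈ (extChartAt (𝓡 n) x₀).target, (extChartAt (𝓡 n) x₀).symm y = x :=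
    ⟨_, (extChartAt (𝓡 n) x₀).map_source hx, (extChartAt (𝓡 n) x₀).left_inv hx⟩
  rw [(extChartAt (𝓡 n) x₀).right_inv hy, metricCoord_apply, ofCoord_toCoord hy, ofCoord_toCoord hy]

lemma isUnit_det_metricMatrix {x₀ : M} {y : EuclideanSpace ℝ (Fin n)}
    (hy : y ∈ (extChartAt (𝓡 n) x₀).target) : IsUnit (metricMatrix x₀ y).det := by
  rw [← Matrix.isUnit_iff_isUnit_det, ← Matrix.mulVec_injective_iff_isUnit]
  refine (injective_iff_map_eq_zero (metricMatrix x₀ y).mulVecLin).2 fun v hv => ?_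
  by_contra hne
  have hne' : WithLp.toLp 2 v ≠ 0 := fun h => hne (by simpa using h)
  refine (metricCoord_pos (x₀ := x₀) hy hne').ne' ?_
  have h1 : ∀ i, metricCoord x₀ y (EuclideanSpace.single i 1) (WithLp.toLp 2 v) = 0 := fun i => by
    have := congrFun hv i
    rw [← sum_smul_single (WithLp.toLp 2 v)]
    simpa [Matrix.mulVec, dotProduct, metricMatrix_apply, mul_comm] using this
  nth_rewrite 1 [← sum_smul_single (WithLp.toLp 2 v)]
  simp [h1]

lemma isInvertible_metricCoord {x₀ : M} {y : EuclideanSpace ℝ (Fin n)}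
    (hy : y ∈ (extChartAt (𝓡 n) x₀).target) : (metricCoord x₀ y).IsInvertible := by
  have hinj : Function.Injective (metricCoord x₀ y) := by
    refine (injective_iff_map_eq_zero _).2 fun u hu => ?_
    by_contra hne
    exact (metricCoord_pos hy hne).ne' (by rw [hu]; rfl)
  have hdim : Module.finrank ℝ (EuclideanSpace ℝ (Fin n)) =
      Module.finrank ℝ (EuclideanSpace ℝ (Fin n) →L[ℝ] ℝ) := by
    rw [LinearEquiv.finrank_eq (LinearMap.toContinuousLinearMap (𝕜 := ℝ)
      (E := EuclideanSpace ℝ (Fin n)) (F' := ℝ)).symm]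
    exact (Subspace.dual_finrank_eq (K := ℝ) (V := EuclideanSpace ℝ (Fin n))).symm
  exact ⟨(LinearEquiv.ofInjectiveOfFinrankEq (metricCoord x₀ y).toLinearMap hinj
    hdim).toContinuousLinearEquiv, by ext; rfl⟩

variable [IsContMDiffRiemannianBundle (𝓡 n) ∞ (EuclideanSpace ℝ (Fin n))
      (fun x : M => TangentSpace (𝓡 n) x)]

lemma contDiffAt_metricCoord {x₀ : M} {y : EuclideanSpace ℝ (Fin n)}
    (hy : y ∈ (extChartAt (𝓡 n) x₀).target) : ContDiffAt ℝ ∞ (metricCoord x₀) y := by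
  refine ContDiffOn.contDiffAt ?_ ((isOpen_extChartAt_target x₀).mem_nhds hy)
  refine contDiffOn_clm_apply.2 fun u => contDiffOn_clm_apply.2 fun v z hz => ?_
  exact ((contMDiffAt_ofCoord hz u).inner_bundle
    (contMDiffAt_ofCoord hz v)).contDiffAt.contDiffWithinAt

lemma metricPartial_eq {x₀ : M} {y : EuclideanSpace ℝ (Fin n)}
    (hy : y ∈ (extChartAt (𝓡 n) x₀).target) (l i j : Fin n) :
    metricPartial x₀ l i j y = fderiv ℝ (metricCoord x₀) y (EuclideanSpace.single l 1)
      (EuclideanSpace.single i 1) (EuclideanSpace.single j 1) := by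
  have hG : DifferentiableAt ℝ (metricCoord x₀) y :=
    (contDiffAt_metricCoord hy).differentiableAt (by simp)
  obtain ⟨L, hL, hL'⟩ := hasFDerivAt_metric_apply hG
    (hasFDerivAt_const (EuclideanSpace.single i (1 : ℝ)) y)
    (hasFDerivAt_const (EuclideanSpace.single j (1 : ℝ)) y)
  rw [metricPartial]
  simp only [metricMatrix_apply]
  rw [hL.fderiv, hL']
  simp

/-- The Christoffel symbols are those of the Levi-Civita connection. -/
lemma koszul_christoffelCoord {x₀ : M} {y : EuclideanSpace ℝ (Fin n)}
    (hy : y ∈ (extChartAt (𝓡 n) x₀).target) :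
    Koszul (metricCoord x₀) (christoffelCoord x₀ y) y := by
  have hb : ∀ i j l, metricCoord x₀ y (christoffelCoord x₀ y (EuclideanSpace.single i 1)
      (EuclideanSpace.single j 1)) (EuclideanSpace.single l 1) =
      (1 / 2) * (fderiv ℝ (metricCoord x₀) y (EuclideanSpace.single i 1)
        (EuclideanSpace.single j 1) (EuclideanSpace.single l 1)
      + fderiv ℝ (metricCoord x₀) y (EuclideanSpace.single j 1)
        (EuclideanSpace.single i 1) (EuclideanSpace.single l 1)
      - fderiv ℝ (metricCoord x₀) y (EuclideanSpace.single l 1)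
        (EuclideanSpace.single i 1) (EuclideanSpace.single j 1)) := by
    intro i j l
    rw [← metricPartial_eq hy, ← metricPartial_eq hy, ← metricPartial_eq hy, christoffelCoord_single]
    simp only [map_sum, map_smul, _root_.sum_apply, _root_.smul_apply, smul_eq_mul,
      ← metricMatrix_apply, christoffel, mul_assoc, Finset.sum_mul, ← Finset.mul_sum]
    congr 1
    have hinv : (metricMatrix x₀ y)⁻¹.transpose * metricMatrix x₀ y = 1 := by
      have hsymm : (metricMatrix x₀ y).transpose = metricMatrix x₀ y := by
        ext a b
        exact metricCoord_symm x₀ y _ _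
      rw [Matrix.transpose_nonsing_inv, hsymm,
        Matrix.nonsing_inv_mul _ (isUnit_det_metricMatrix hy)]
    have hml : ∀ m, ∑ k, (metricMatrix x₀ y)⁻¹ k m * metricMatrix x₀ y k l =
        (1 : Matrix (Fin n) (Fin n) ℝ) m l := fun m => by
      rw [← hinv, Matrix.mul_apply]; rfl
    rw [Finset.sum_comm]
    calc _ = ∑ m, (∑ k, (metricMatrix x₀ y)⁻¹ k m * metricMatrix x₀ y k l) *
          (metricPartial x₀ i j m y + metricPartial x₀ j i m y - metricPartial x₀ m i j y) := by
          refine Finset.sum_congr rfl fun m _ => ?_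
          rw [Finset.sum_mul]
          refine Finset.sum_congr rfl fun k _ => ?_
          ring
      _ = _ := by
          simp [hml, Matrix.one_apply]
  intro u v w
  induction u using euclideanSpace_induction with
  | h0 => simp
  | hadd a b ha hb' =>
    simp only [map_add, _root_.add_apply, ha, hb']
    ring
  | hsmul a b hb' =>
    simp only [map_smul, _root_.smul_apply, smul_eq_mul, hb']
    ring
  | h i =>
    induction v using euclideanSpace_induction with
    | h0 => simp
    | hadd a b ha hb' =>
      simp only [map_add, _root_.add_apply, ha, hb']
      ring
    | hsmul a b hb' =>
      simp only [map_smul, _root_.smul_apply, smul_eq_mul, hb']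
      ring
    | h j =>
      induction w using euclideanSpace_induction with
      | h0 => simp
      | hadd a b ha hb' =>
        simp only [map_add, _root_.add_apply, ha, hb']
        ring
      | hsmul a b hb' =>
        simp only [map_smul, _root_.smul_apply, smul_eq_mul, hb']
        ring
      | h l => exact hb i j l

lemma contDiffAt_christoffelCoord {x₀ : M} {y : EuclideanSpace ℝ (Fin n)}
    (hy : y ∈ (extChartAt (𝓡 n) x₀).target) : ContDiffAt ℝ ∞ (christoffelCoord x₀) y := by
  refine ContDiffOn.contDiffAt ?_ ((isOpen_extChartAt_target x₀).mem_nhds hy)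
  refine contDiffOn_clm_apply.2 fun u => contDiffOn_clm_apply.2 fun v z hz =>
    ContDiffAt.contDiffWithinAt ?_
  -- By the Koszul formula, `Γ(u, v)` is the inverse of the metric applied to the form `K`.
  let K : EuclideanSpace ℝ (Fin n) → EuclideanSpace ℝ (Fin n) →L[ℝ] ℝ := fun z =>
    (1 / 2 : ℝ) • (fderiv ℝ (metricCoord x₀) z u v + fderiv ℝ (metricCoord x₀) z v u
      - ((fderiv ℝ (metricCoord x₀) z).flip u).flip v)
  have hD : ContDiffAt ℝ ∞ (fderiv ℝ (metricCoord x₀)) z :=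
    (contDiffAt_metricCoord hz).fderiv_right (by simp)
  have hK : ContDiffAt ℝ ∞ K z := by
    have hflip : ContDiffAt ℝ ∞ (fun z => (fderiv ℝ (metricCoord x₀) z).flip) z :=
      (ContinuousLinearMap.flipₗᵢ ℝ (EuclideanSpace ℝ (Fin n)) (EuclideanSpace ℝ (Fin n))
        (EuclideanSpace ℝ (Fin n) →L[ℝ] ℝ)).contDiff.contDiffAt.comp z hD
    have hflip' : ContDiffAt ℝ ∞ (fun z => ((fderiv ℝ (metricCoord x₀) z).flip u).flip) z :=
      (ContinuousLinearMap.flipₗᵢ ℝ (EuclideanSpace ℝ (Fin n)) (EuclideanSpace ℝ (Fin n))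
        ℝ).contDiff.contDiffAt.comp z (hflip.clm_apply contDiffAt_const)
    exact ContDiffAt.const_smul (1 / 2 : ℝ) ((((hD.clm_apply contDiffAt_const).clm_apply contDiffAt_const).add
      ((hD.clm_apply contDiffAt_const).clm_apply contDiffAt_const)).sub
      (hflip'.clm_apply contDiffAt_const))
  have hinv : ContDiffAt ℝ ∞ (fun z => (metricCoord x₀ z).inverse) z :=
    (isInvertible_metricCoord hz).contDiffAt_map_inverse.comp z (contDiffAt_metricCoord hz)
  refine (hinv.clm_apply hK).congr_of_eventuallyEq ?_
  filter_upwards [(isOpen_extChartAt_target x₀).mem_nhds hz] with z hz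
  have h : metricCoord x₀ z (christoffelCoord x₀ z u v) = K z := by
    ext1 w
    simpa [K] using koszul_christoffelCoord hz u v w
  exact ((isInvertible_metricCoord hz).inverse_apply_eq.2 h.symm).symm

end MetricChart

/-! ### The metric along a flow -/

section MetricFlow

variable {n : ℕ} {M : Type*} [TopologicalSpace M] [ChartedSpace (EuclideanSpace ℝ (Fin n)) M]
  [IsManifold (𝓡 n) ∞ M] [RiemannianBundle (fun x : M => TangentSpace (𝓡 n) x)]
  [IsContMDiffRiemannianBundle (𝓡 n) ∞ (EuclideanSpace ℝ (Fin n))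
      (fun x : M => TangentSpace (𝓡 n) x)]

/-- The derivative of the length of a vector transported by a flow is the Lie derivative of the
metric. -/
lemma IsOneParameterGroup.hasDerivAt_inner {φ : ℝ → M → M} (hφ : IsOneParameterGroup (𝓡 n) φ)
    {x₀ : M} {y : EuclideanSpace ℝ (Fin n)} (hy : y ∈ (extChartAt (𝓡 n) x₀).target)
    (r : EuclideanSpace ℝ (Fin n)) :
    HasDerivAt (fun t => (inner ℝ
        (mfderiv (𝓡 n) (𝓡 n) (φ t) ((extChartAt (𝓡 n) x₀).symm y) (ofCoord x₀ y r))
        (mfderiv (𝓡 n) (𝓡 n) (φ t) ((extChartAt (𝓡 n) x₀).symm y) (ofCoord x₀ y r)) : ℝ))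
      (lieMetric (metricCoord x₀) (fieldCoord (infinitesimalGenerator (𝓡 n) φ) x₀) y r r) 0 := by
  have h0 : flowCoord φ x₀ (0, y) = y := by
    rw [flowCoord, hφ.map_zero, (extChartAt (𝓡 n) x₀).right_inv hy]
  have h1 : fderiv ℝ (fun z => flowCoord φ x₀ (0, z)) y r = r := by
    rw [← hφ.toCoord_mfderiv hy r (by rw [hφ.map_zero]; exact (extChartAt (𝓡 n) x₀).map_target hy)]
    have hid : φ 0 = id := funext hφ.map_zero
    have := toCoord_ofCoord hy r
    rw [hid, mfderiv_id]
    exact this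
  have hG : HasFDerivAt (metricCoord x₀) (fderiv ℝ (metricCoord x₀) y) (flowCoord φ x₀ (0, y)) := by
    rw [h0]
    exact ((contDiffAt_metricCoord hy).differentiableAt (by simp)).hasFDerivAt
  have hd := hφ.hasDerivAt_tangentMap hy r
  have hc := hG.comp_hasDerivAt (0 : ℝ) (hφ.hasDerivAt_flowCoord hy)
  have h := (hc.clm_apply hd).clm_apply hd
  simp only [Function.comp_apply, h0, h1] at h
  refine HasDerivAt.congr_of_eventuallyEq (h.congr_deriv ?_) ?_
  · simp [lieMetric]
  · filter_upwards [hφ.eventually_mem_source hy] with t ht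
    rw [← hφ.toCoord_mfderiv hy r ht]
    exact (metricCoord_toCoord ht _ _).symm

end MetricFlow

/-! ### Transformation of the Christoffel symbols between charts -/

section TangentChart

variable {n : ℕ} {M : Type*} [TopologicalSpace M] [ChartedSpace (EuclideanSpace ℝ (Fin n)) M]

/-- The change of coordinates from the chart at `x` to the chart at `x₀`. -/
noncomputable def transition (x₀ x : M) (z : EuclideanSpace ℝ (Fin n)) :
    EuclideanSpace ℝ (Fin n) :=
  extChartAt (𝓡 n) x₀ ((extChartAt (𝓡 n) x).symm z)

variable {x₀ x : M}

lemma eventually_mem_charts (hx : x ∈ (extChartAt (𝓡 n) x₀).source) :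
    ∀ᶠ z in 𝓝 (extChartAt (𝓡 n) x x), z ∈ (extChartAt (𝓡 n) x).target ∧
      (extChartAt (𝓡 n) x).symm z ∈ (extChartAt (𝓡 n) x₀).source := by
  refine Filter.Eventually.and (extChartAt_target_mem_nhds x) ?_
  refine (continuousAt_extChartAt_symm x).eventually_mem ((isOpen_extChartAt_source x₀).mem_nhds ?_)
  rwa [extChartAt_to_inv]

variable [IsManifold (𝓡 n) ∞ M]

lemma contDiffAt_transition (hx : x ∈ (extChartAt (𝓡 n) x₀).source) :
    ContDiffAt ℝ ∞ (transition x₀ x) (extChartAt (𝓡 n) x x) := by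
  have h1 : ContMDiffAt 𝓘(ℝ, EuclideanSpace ℝ (Fin n)) (𝓡 n) ∞ (extChartAt (𝓡 n) x).symm
      (extChartAt (𝓡 n) x x) :=
    (contMDiffOn_extChartAt_symm x).contMDiffAt (extChartAt_target_mem_nhds x)
  have h3 : ContMDiffAt (𝓡 n) 𝓘(ℝ, EuclideanSpace ℝ (Fin n)) ∞ (extChartAt (𝓡 n) x₀)
      ((extChartAt (𝓡 n) x).symm (extChartAt (𝓡 n) x x)) := by
    rw [extChartAt_to_inv]
    exact contMDiffAt_extChartAt' (by rwa [← extChartAt_source (𝓡 n)])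
  exact (ContMDiffAt.comp _ h3 h1).contDiffAt

lemma toCoord_ofCoord_eq_fderiv {z : EuclideanSpace ℝ (Fin n)}
    (hz : z ∈ (extChartAt (𝓡 n) x).target)
    (hz' : (extChartAt (𝓡 n) x).symm z ∈ (extChartAt (𝓡 n) x₀).source)
    (s : EuclideanSpace ℝ (Fin n)) :
    toCoord x₀ ((extChartAt (𝓡 n) x).symm z) (ofCoord x z s) = fderiv ℝ (transition x₀ x) z s := by
  have k := mfderiv_comp z (mdifferentiableAt_chart hz') (mdifferentiableAt_chart_symm hz)
  rw [mfderiv_eq_fderiv] at k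
  exact (congrArg (fun L => L s) k).symm

lemma toCoord_eq_fderiv (hx : x ∈ (extChartAt (𝓡 n) x₀).source) (v : TangentSpace (𝓡 n) x) :
    toCoord x₀ x v = fderiv ℝ (transition x₀ x) (extChartAt (𝓡 n) x x) v := by
  rw [toCoord, (mdifferentiableAt_chart hx).mfderiv, ModelWithCorners.range_eq_univ,
    fderivWithin_univ]
  rfl

/-- The change of coordinates of the tangent bundle, at the level of its tangent vectors. -/
lemma mfderiv_extChartAt_tangent {p q : TangentBundle (𝓡 n) M}
    (hq : q.1 ∈ (extChartAt (𝓡 n) p.1).source) (a b : EuclideanSpace ℝ (Fin n)) :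
    mfderiv (𝓡 n).tangent 𝓘(ℝ, EuclideanSpace ℝ (Fin n) × EuclideanSpace ℝ (Fin n))
      (extChartAt (𝓡 n).tangent p) q ((a, b) : EuclideanSpace ℝ (Fin n) × EuclideanSpace ℝ (Fin n))
      = (fderiv ℝ (transition p.1 q.1) (extChartAt (𝓡 n) q.1 q.1) a,
        fderiv ℝ (fderiv ℝ (transition p.1 q.1)) (extChartAt (𝓡 n) q.1 q.1) a q.2 +
          fderiv ℝ (transition p.1 q.1) (extChartAt (𝓡 n) q.1 q.1) b) := by
  have hd : MDifferentiableAt (𝓡 n).tangent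
      𝓘(ℝ, EuclideanSpace ℝ (Fin n) × EuclideanSpace ℝ (Fin n)) (extChartAt (𝓡 n).tangent p) q :=
    mdifferentiableAt_extChartAt (by
      rw [← extChartAt_source (𝓡 n).tangent, extChartAt_tangent_source]; exact hq)
  have hτ := contDiffAt_transition hq
  have hτ1 : DifferentiableAt ℝ (transition p.1 q.1) (extChartAt (𝓡 n) q.1 q.1) :=
    hτ.differentiableAt (by simp)
  have hτ2 : DifferentiableAt ℝ (fderiv ℝ (transition p.1 q.1)) (extChartAt (𝓡 n) q.1 q.1) :=
    (hτ.fderiv_right (m := ∞) (by simp)).differentiableAt (by simp)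
  obtain ⟨R, hR⟩ : ∃ R : EuclideanSpace ℝ (Fin n), R = q.2 := ⟨_, rfl⟩
  have h0 : extChartAt (𝓡 n).tangent q q = (extChartAt (𝓡 n) q.1 q.1, R) := by
    rw [extChartAt_tangent (mem_extChartAt_source q.1), toCoord_self, hR]
  have hev : writtenInExtChartAt (𝓡 n).tangent
      𝓘(ℝ, EuclideanSpace ℝ (Fin n) × EuclideanSpace ℝ (Fin n)) q (extChartAt (𝓡 n).tangent p)
      =ᶠ[𝓝 (extChartAt (𝓡 n) q.1 q.1, R)]
      fun z => (transition p.1 q.1 z.1, fderiv ℝ (transition p.1 q.1) z.1 z.2) := by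
    filter_upwards [continuousAt_fst.eventually (eventually_mem_charts hq)] with z hz
    obtain ⟨z, s⟩ := z
    change extChartAt (𝓡 n).tangent p ((extChartAt (𝓡 n).tangent q).symm (z, s)) = _
    rw [extChartAt_tangent_symm hz.1, extChartAt_tangent (by exact hz.2)]
    exact Prod.ext rfl (toCoord_ofCoord_eq_fderiv hz.1 hz.2 s)
  have hD : HasFDerivAt (fun z : EuclideanSpace ℝ (Fin n) × EuclideanSpace ℝ (Fin n) =>
      (transition p.1 q.1 z.1, fderiv ℝ (transition p.1 q.1) z.1 z.2)) _
      (extChartAt (𝓡 n) q.1 q.1, R) :=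
    (HasFDerivAt.comp (extChartAt (𝓡 n) q.1 q.1, R)
      (g := transition p.1 q.1) hτ1.hasFDerivAt hasFDerivAt_fst).prodMk
    ((HasFDerivAt.comp (extChartAt (𝓡 n) q.1 q.1, R)
      (g := fderiv ℝ (transition p.1 q.1)) hτ2.hasFDerivAt hasFDerivAt_fst).clm_apply
      hasFDerivAt_snd)
  rw [hd.mfderiv, ModelWithCorners.range_eq_univ, fderivWithin_univ, h0,
    (hD.congr_of_eventuallyEq hev).fderiv]
  refine Prod.ext ?_ ?_
  · rfl
  · simp only [← hR]
    exact add_comm _ _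

variable [RiemannianBundle (fun x : M => TangentSpace (𝓡 n) x)]
  [IsContMDiffRiemannianBundle (𝓡 n) ∞ (EuclideanSpace ℝ (Fin n))
      (fun x : M => TangentSpace (𝓡 n) x)]

/-- The transformation law of the Christoffel symbols, from the chart at `x` to the chart at
`x₀`. -/
lemma toCoord_christoffelAt (hx : x ∈ (extChartAt (𝓡 n) x₀).source) (u v : TangentSpace (𝓡 n) x) :
    toCoord x₀ x (christoffelAt x u v) =
      christoffelCoord x₀ (extChartAt (𝓡 n) x₀ x) (toCoord x₀ x u) (toCoord x₀ x v) +
        fderiv ℝ (fderiv ℝ (transition x₀ x)) (extChartAt (𝓡 n) x x) u v := by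
  have hy := (extChartAt (𝓡 n) x₀).map_source hx
  have hτx : transition x₀ x (extChartAt (𝓡 n) x x) = extChartAt (𝓡 n) x₀ x := by
    rw [transition, extChartAt_to_inv]
  rw [toCoord_eq_fderiv hx, toCoord_eq_fderiv hx, toCoord_eq_fderiv hx, christoffelAt_eq]
  refine Koszul.map (G₁ := metricCoord x) (G₂ := metricCoord x₀)
    ((contDiffAt_transition hx).of_le ENat.LEInfty.out) ?_ ?_ ?_ ?_ ?_ ?_ ?_ ?_ u v
  · rw [hτx]
    exact (contDiffAt_metricCoord hy).differentiableAt (by simp)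
  · filter_upwards [eventually_mem_charts hx] with z hz u v
    rw [← toCoord_ofCoord_eq_fderiv hz.1 hz.2, ← toCoord_ofCoord_eq_fderiv hz.1 hz.2, transition,
      metricCoord_toCoord hz.2, metricCoord_apply]
  · intro w
    obtain ⟨v, hv⟩ : ∃ v : TangentSpace (𝓡 n) x, toCoord x₀ x v = w := by
      obtain ⟨y, hy, rfl⟩ : ∃ y ∈ (extChartAt (𝓡 n) x₀).target, (extChartAt (𝓡 n) x₀).symm y = x :=
        ⟨_, hy, (extChartAt (𝓡 n) x₀).left_inv hx⟩
      exact ⟨ofCoord x₀ y w, toCoord_ofCoord ‹_› w⟩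
    exact ⟨v, by rw [← hv, toCoord_eq_fderiv hx]⟩
  · exact metricCoord_symm x₀ _
  · rw [hτx]
    exact fun u hu => metricCoord_pos hy hu
  · exact (contDiffAt_metricCoord (mem_extChartAt_target x)).differentiableAt (by simp)
  · exact koszul_christoffelCoord (mem_extChartAt_target x)
  · rw [hτx]
    exact koszul_christoffelCoord hy

end TangentChart

/-! ### The rotation by a right angle on an oriented surface -/

section AreaForm

lemma areaForm_pos {V : Type*} [NormedAddCommGroup V] [InnerProductSpace ℝ V]
    [Fact (Module.finrank ℝ V = 2)] (o : Orientation ℝ V (Fin 2)) (b : Module.Basis (Fin 2) ℝ V)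
    (hb : b.orientation = o) : 0 < o.areaForm (b 0) (b 1) := by
  have he := o.finOrthonormalBasis_orientation (n := 2) (by norm_num) Fact.out
  rw [o.areaForm_to_volumeForm, o.volumeForm_robust _ he]
  have := ((o.finOrthonormalBasis (by norm_num) Fact.out).toBasis.orientation_eq_iff_det_pos b).1
    (he.trans hb.symm)
  convert! this using 2
  ext i
  fin_cases i <;> rfl

lemma euclideanSpace_two (u : EuclideanSpace ℝ (Fin 2)) :
    u = u 0 • EuclideanSpace.single 0 (1 : ℝ) + u 1 • EuclideanSpace.single 1 (1 : ℝ) := by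
  ext i
  fin_cases i <;> simp

end AreaForm

section RotationChart

variable {M : Type*} [TopologicalSpace M] [ChartedSpace (EuclideanSpace ℝ (Fin 2)) M]
  [RiemannianBundle (fun x : M => TangentSpace (𝓡 2) x)]
  {o : (x : M) → Orientation ℝ (TangentSpace (𝓡 2) x) (Fin 2)} {x₀ : M}
  {y : EuclideanSpace ℝ (Fin 2)}

/-- The rotation by a right angle, in the chart at `x₀`. -/
noncomputable def rotCoord (o : (x : M) → Orientation ℝ (TangentSpace (𝓡 2) x) (Fin 2)) (x₀ : M)
    (y : EuclideanSpace ℝ (Fin 2)) : EuclideanSpace ℝ (Fin 2) →L[ℝ] EuclideanSpace ℝ (Fin 2) :=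
  (toCoord x₀ ((extChartAt (𝓡 2) x₀).symm y)).comp
    (((o ((extChartAt (𝓡 2) x₀).symm y)).rightAngleRotation.toContinuousLinearEquiv :
      TangentSpace (𝓡 2) ((extChartAt (𝓡 2) x₀).symm y) →L[ℝ] _).comp (ofCoord x₀ y))

lemma rotCoord_apply (r : EuclideanSpace ℝ (Fin 2)) :
    rotCoord o x₀ y r = toCoord x₀ ((extChartAt (𝓡 2) x₀).symm y)
      (perp o ((extChartAt (𝓡 2) x₀).symm y) (ofCoord x₀ y r)) := rfl

/-- The coefficient of the area form in the chart at `x₀`. -/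
noncomputable def areaCoord (o : (x : M) → Orientation ℝ (TangentSpace (𝓡 2) x) (Fin 2)) (x₀ : M)
    (y : EuclideanSpace ℝ (Fin 2)) : ℝ :=
  (o ((extChartAt (𝓡 2) x₀).symm y)).areaForm (ofCoord x₀ y (EuclideanSpace.single 0 1))
    (ofCoord x₀ y (EuclideanSpace.single 1 1))

lemma areaForm_ofCoord (u v : EuclideanSpace ℝ (Fin 2)) :
    (o ((extChartAt (𝓡 2) x₀).symm y)).areaForm (ofCoord x₀ y u) (ofCoord x₀ y v) =
      areaCoord o x₀ y * (u 0 * v 1 - u 1 * v 0) := by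
  nth_rewrite 1 [euclideanSpace_two u, euclideanSpace_two v]
  simp only [map_add, map_smul, LinearMap.add_apply, LinearMap.smul_apply,
    Orientation.areaForm_apply_self, smul_eq_mul]
  rw [(o ((extChartAt (𝓡 2) x₀).symm y)).areaForm_swap (ofCoord x₀ y (EuclideanSpace.single 1 1))]
  simp only [areaCoord]
  ring

lemma areaCoord_sq :
    areaCoord o x₀ y ^ 2 =
      metricCoord x₀ y (EuclideanSpace.single 0 1) (EuclideanSpace.single 0 1) *
        metricCoord x₀ y (EuclideanSpace.single 1 1) (EuclideanSpace.single 1 1) -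
        metricCoord x₀ y (EuclideanSpace.single 0 1) (EuclideanSpace.single 1 1) ^ 2 := by
  have h := (o ((extChartAt (𝓡 2) x₀).symm y)).inner_sq_add_areaForm_sq
    (ofCoord x₀ y (EuclideanSpace.single 0 1)) (ofCoord x₀ y (EuclideanSpace.single 1 1))
  rw [← real_inner_self_eq_norm_sq, ← real_inner_self_eq_norm_sq] at h
  simp only [metricCoord_apply, areaCoord]
  linarith

variable [IsManifold (𝓡 2) ∞ M]

lemma ofCoord_rotCoord (hy : y ∈ (extChartAt (𝓡 2) x₀).target) (r : EuclideanSpace ℝ (Fin 2)) :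
    ofCoord x₀ y (rotCoord o x₀ y r) =
      perp o ((extChartAt (𝓡 2) x₀).symm y) (ofCoord x₀ y r) := by
  rw [rotCoord_apply, ofCoord_toCoord hy]

lemma isRightAngleRotation_rotCoord (hy : y ∈ (extChartAt (𝓡 2) x₀).target) :
    IsRightAngleRotation (metricCoord x₀ y) (rotCoord o x₀ y) where
  symm := metricCoord_symm x₀ y
  pos _ hu := metricCoord_pos hy hu
  isometry u v := by
    rw [metricCoord_apply, ofCoord_rotCoord hy, ofCoord_rotCoord hy, metricCoord_apply, perp, perp]
    exact LinearIsometryEquiv.inner_map_map _ _ _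
  ortho u := by
    rw [metricCoord_apply, ofCoord_rotCoord hy, perp]
    exact Orientation.inner_rightAngleRotation_self _ _

/-- An orientation given by continuous frames has an area form of locally constant sign. -/
lemma exists_sign_areaCoord {U : Set M} (ho : IsOrientationOn U o)
    (hy : y ∈ (extChartAt (𝓡 2) x₀).target) (hU : (extChartAt (𝓡 2) x₀).symm y ∈ U) :
    ∃ s : ℝ, ∀ᶠ z in 𝓝 y, 0 < s * areaCoord o x₀ z := by
  obtain ⟨W, hW, b, hb, hbo⟩ := ho _ hU
  have ht : (extChartAt (𝓡 2) x₀).target ∈ 𝓝 y := (isOpen_extChartAt_target x₀).mem_nhds hy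
  have hc : ContinuousAt (extChartAt (𝓡 2) x₀).symm y := continuousAt_extChartAt_symm'' hy
  let β : Fin 2 → EuclideanSpace ℝ (Fin 2) → EuclideanSpace ℝ (Fin 2) := fun i =>
    fieldCoord (fun x => b x i) x₀
  have hβ : ∀ i, ContinuousAt (β i) y := fun i => by
    have h1 : ContinuousAt (fun z => (⟨(extChartAt (𝓡 2) x₀).symm z,
        b ((extChartAt (𝓡 2) x₀).symm z) i⟩ : TangentBundle (𝓡 2) M)) y :=
      ((hb i).continuousAt hW).comp_of_eq hc rfl
    have hs := (extChartAt (𝓡 2) x₀).map_target hy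
    let e := trivializationAt (EuclideanSpace ℝ (Fin 2)) (TangentSpace (𝓡 2) (M := M)) x₀
    have h2 := (e.continuousOn.continuousAt (e.open_source.mem_nhds (by
      rw [TangentBundle.trivializationAt_source]; rwa [extChartAt_source] at hs))).comp_of_eq h1 rfl
    refine (continuousAt_snd.comp h2).congr ?_
    filter_upwards [ht] with z hz
    exact trivializationAt_snd (p := ⟨(extChartAt (𝓡 2) x₀).symm z,
      b ((extChartAt (𝓡 2) x₀).symm z) i⟩) ((extChartAt (𝓡 2) x₀).map_target hz)
  -- the determinant, in the chart, of the frame that defines the orientation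
  let m : EuclideanSpace ℝ (Fin 2) → ℝ := fun z => β 0 z 0 * β 1 z 1 - β 0 z 1 * β 1 z 0
  have hcoord : ∀ i j, ContinuousAt (fun z => β i z j) y := fun i j =>
    (EuclideanSpace.proj j : EuclideanSpace ℝ (Fin 2) →L[ℝ] ℝ).continuous.continuousAt.comp (hβ i)
  have hm : ContinuousAt m y :=
    ((hcoord 0 0).mul (hcoord 1 1)).sub ((hcoord 0 1).mul (hcoord 1 0))
  have hpos : ∀ᶠ z in 𝓝 y, 0 < areaCoord o x₀ z * m z := by
    filter_upwards [ht, hc.eventually hW] with z hz hzW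
    have h := areaForm_pos _ _ (hbo _ hzW)
    have e : ∀ i, b ((extChartAt (𝓡 2) x₀).symm z) i = ofCoord x₀ z (β i z) := fun i =>
      (ofCoord_toCoord hz _).symm
    rw [e, e, areaForm_ofCoord] at h
    exact h
  refine ⟨m y, ?_⟩
  have hm0 : m y ≠ 0 := fun h0 => by simpa [h0] using hpos.self_of_nhds
  have hmm : ∀ᶠ z in 𝓝 y, 0 < m y * m z :=
    (continuousAt_const.mul hm).eventually (lt_mem_nhds (mul_self_pos.2 hm0))
  filter_upwards [hpos, hmm] with z h1 h2
  by_contra! h3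
  nlinarith [mul_pos h1 h2, mul_nonneg (sq_nonneg (m z)) (neg_nonneg.2 h3)]

variable [IsContMDiffRiemannianBundle (𝓡 2) ∞ (EuclideanSpace ℝ (Fin 2))
      (fun x : M => TangentSpace (𝓡 2) x)]

lemma differentiableAt_areaCoord {U : Set M} (ho : IsOrientationOn U o)
    (hy : y ∈ (extChartAt (𝓡 2) x₀).target) (hU : (extChartAt (𝓡 2) x₀).symm y ∈ U) :
    DifferentiableAt ℝ (areaCoord o x₀) y := by
  obtain ⟨s, hs⟩ := exists_sign_areaCoord ho hy hU
  have hG : DifferentiableAt ℝ (metricCoord x₀) y :=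
    (contDiffAt_metricCoord hy).differentiableAt (by simp)
  have hg : ∀ i j, DifferentiableAt ℝ (fun z => metricCoord x₀ z (EuclideanSpace.single i 1)
      (EuclideanSpace.single j 1)) y := fun i j =>
    (hG.clm_apply (differentiableAt_const _)).clm_apply (differentiableAt_const _)
  have hsq : DifferentiableAt ℝ (fun z => areaCoord o x₀ z ^ 2) y := by
    simp only [areaCoord_sq]
    exact ((hg 0 0).mul (hg 1 1)).sub ((hg 0 1).pow 2)
  have hne : areaCoord o x₀ y ^ 2 ≠ 0 := by
    have := hs.self_of_nhds
    intro h
    rw [pow_eq_zero_iff (by norm_num)] at h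
    simp [h] at this
  have hroot := hsq.sqrt hne
  rcases lt_trichotomy s 0 with h | h | h
  · refine hroot.neg.congr_of_eventuallyEq ?_
    filter_upwards [hs] with z hz
    have : areaCoord o x₀ z < 0 := by
      by_contra! h'
      nlinarith
    simp [Real.sqrt_sq_eq_abs, abs_of_neg this]
  · exact absurd hs.self_of_nhds (by simp [h])
  · refine hroot.congr_of_eventuallyEq ?_
    filter_upwards [hs] with z hz
    have : 0 < areaCoord o x₀ z := by
      by_contra! h'
      nlinarith
    simp [Real.sqrt_sq_eq_abs, abs_of_pos this]

/-- The rotation by a right angle is smooth: it is obtained from the area form by raising an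
index. -/
lemma differentiableAt_rotCoord {U : Set M} (ho : IsOrientationOn U o)
    (hy : y ∈ (extChartAt (𝓡 2) x₀).target) (hU : (extChartAt (𝓡 2) x₀).symm y ∈ U) :
    DifferentiableAt ℝ (rotCoord o x₀) y := by
  let δ : EuclideanSpace ℝ (Fin 2) →L[ℝ] EuclideanSpace ℝ (Fin 2) →L[ℝ] ℝ :=
    (EuclideanSpace.proj 0 : EuclideanSpace ℝ (Fin 2) →L[ℝ] ℝ).smulRight (EuclideanSpace.proj 1) -
    (EuclideanSpace.proj 1 : EuclideanSpace ℝ (Fin 2) →L[ℝ] ℝ).smulRight (EuclideanSpace.proj 0)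
  have hinv : DifferentiableAt ℝ (fun z => (metricCoord x₀ z).inverse) y :=
    ((isInvertible_metricCoord hy).contDiffAt_map_inverse.comp y
      (contDiffAt_metricCoord hy)).differentiableAt (by simp)
  refine (hinv.clm_comp ((differentiableAt_areaCoord ho hy hU).smul_const δ)).congr_of_eventuallyEq
    ?_
  filter_upwards [(isOpen_extChartAt_target x₀).mem_nhds hy] with z hz
  ext1 u
  refine ((isInvertible_metricCoord hz).inverse_apply_eq.2 ?_).symm
  ext1 v
  rw [metricCoord_apply, ofCoord_rotCoord hz, perp]
  refine Eq.trans ?_ (Orientation.inner_rightAngleRotation_left _ _ _).symm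
  rw [areaForm_ofCoord]
  simp [δ]

/-- The field `f₁` in the coordinates `(y, r)` of the tangent bundle. -/
lemma mfderiv_extChartAt_f₁ {p : TangentBundle (𝓡 2) M} (hy : y ∈ (extChartAt (𝓡 2) p.1).target)
    (r : EuclideanSpace ℝ (Fin 2)) :
    mfderiv (𝓡 2).tangent 𝓘(ℝ, EuclideanSpace ℝ (Fin 2) × EuclideanSpace ℝ (Fin 2))
      (extChartAt (𝓡 2).tangent p) ⟨(extChartAt (𝓡 2) p.1).symm y, ofCoord p.1 y r⟩
      (f₁ o ⟨(extChartAt (𝓡 2) p.1).symm y, ofCoord p.1 y r⟩) =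
    (rotCoord o p.1 y r,
      -rotCoord o p.1 y r - christoffelCoord p.1 y (rotCoord o p.1 y r) r) := by
  have hs := (extChartAt (𝓡 2) p.1).map_target hy
  have hΓ := toCoord_christoffelAt hs
    (perp o ((extChartAt (𝓡 2) p.1).symm y) (ofCoord p.1 y r)) (ofCoord p.1 y r)
  have hJ := toCoord_eq_fderiv hs (perp o ((extChartAt (𝓡 2) p.1).symm y) (ofCoord p.1 y r))
  rw [← rotCoord_apply, toCoord_ofCoord hy, (extChartAt (𝓡 2) p.1).right_inv hy] at hΓ
  rw [← rotCoord_apply] at hJ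
  rw [toCoord_eq_fderiv hs] at hΓ
  have key : ∀ (L : EuclideanSpace ℝ (Fin 2) →L[ℝ] EuclideanSpace ℝ (Fin 2))
      (u w c d j : EuclideanSpace ℝ (Fin 2)), j = L u → L w = c + d → d + L (-u - w) = -j - c := by
    intro L u w c d j h1 h2
    rw [map_sub, map_neg, ← h1, h2]
    abel
  exact (mfderiv_extChartAt_tangent (by exact hs) _ _).trans
    (Prod.ext hJ.symm (key _ _ _ _ _ _ hJ hΓ))

end RotationChart

/-! ### Functions with vanishing differential -/

section LocallyConstant

variable {n : ℕ} {M : Type*} [TopologicalSpace M] [ChartedSpace (EuclideanSpace ℝ (Fin n)) M]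
  [IsManifold (𝓡 n) ∞ M]

lemma isLocallyConstant_of_hasMFDerivAt_zero {f : M → ℝ}
    (hf : ∀ x, HasMFDerivAt (𝓡 n) 𝓘(ℝ, ℝ) f x 0) : IsLocallyConstant f := by
  rw [IsLocallyConstant.iff_eventually_eq]
  intro x
  obtain ⟨ε, hε, hB⟩ := Metric.mem_nhds_iff.1 (extChartAt_target_mem_nhds (I := 𝓡 n) x)
  have hd : ∀ z ∈ Metric.ball (extChartAt (𝓡 n) x x) ε,
      HasFDerivAt (f ∘ (extChartAt (𝓡 n) x).symm) (0 : EuclideanSpace ℝ (Fin n) →L[ℝ] ℝ) z := by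
    intro z hz
    have h := (hf ((extChartAt (𝓡 n) x).symm z)).comp z
      (mdifferentiableAt_chart_symm (hB hz)).hasMFDerivAt
    rw [ContinuousLinearMap.zero_comp] at h
    exact h.hasFDerivAt
  have hx : extChartAt (𝓡 n) x x ∈ Metric.ball (extChartAt (𝓡 n) x x) ε := Metric.mem_ball_self hε
  filter_upwards [extChartAt_source_mem_nhds (I := 𝓡 n) x,
    (continuousAt_extChartAt (I := 𝓡 n) x).eventually_mem (Metric.ball_mem_nhds _ hε)] with z hz hz'
  have := Metric.isOpen_ball.is_const_of_fderiv_eq_zero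
    (convex_ball (extChartAt (𝓡 n) x x) ε).isPreconnected
    (fun w hw => (hd w hw).differentiableAt.differentiableWithinAt)
    (fun w hw => (hd w hw).fderiv) hz' hx
  rwa [Function.comp_apply, Function.comp_apply, (extChartAt (𝓡 n) x).left_inv hz,
    extChartAt_to_inv] at this

end LocallyConstant

/-! ### Conformal fields and homotheties -/

section Homothety

variable {n : ℕ} {M : Type*} [TopologicalSpace M] [ChartedSpace (EuclideanSpace ℝ (Fin n)) M]
  [IsManifold (𝓡 n) ∞ M] [RiemannianBundle (fun x : M => TangentSpace (𝓡 n) x)]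

/-- `L_X g = μ g` for a function `μ`: the field `X` is conformal, and `μ` is the infinitesimal
scale factor. The identity is written, around every point, in the chart at this point. -/
def IsConformalWith (X : (x : M) → TangentSpace (𝓡 n) x) (μ : M → ℝ) : Prop :=
  ∀ x₀ : M, ∀ y ∈ (extChartAt (𝓡 n) x₀).target, ∀ u v,
    lieMetric (metricCoord x₀) (fieldCoord X x₀) y u v =
      μ ((extChartAt (𝓡 n) x₀).symm y) * metricCoord x₀ y u v

variable [IsContMDiffRiemannianBundle (𝓡 n) ∞ (EuclideanSpace ℝ (Fin n))
      (fun x : M => TangentSpace (𝓡 n) x)] {φ : ℝ → M → M}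

lemma IsOneParameterGroup.hasDerivAt_inner_toCoord (hφ : IsOneParameterGroup (𝓡 n) φ) {x₀ x : M}
    (hx : x ∈ (extChartAt (𝓡 n) x₀).source) (v : TangentSpace (𝓡 n) x) :
    HasDerivAt (fun t => (inner ℝ (mfderiv (𝓡 n) (𝓡 n) (φ t) x v)
        (mfderiv (𝓡 n) (𝓡 n) (φ t) x v) : ℝ))
      (lieMetric (metricCoord x₀) (fieldCoord (infinitesimalGenerator (𝓡 n) φ) x₀)
        (extChartAt (𝓡 n) x₀ x) (toCoord x₀ x v) (toCoord x₀ x v)) 0 := by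
  obtain ⟨y, hy, rfl⟩ : ∃ y ∈ (extChartAt (𝓡 n) x₀).target, (extChartAt (𝓡 n) x₀).symm y = x :=
    ⟨_, (extChartAt (𝓡 n) x₀).map_source hx, (extChartAt (𝓡 n) x₀).left_inv hx⟩
  have h := hφ.hasDerivAt_inner hy (toCoord x₀ ((extChartAt (𝓡 n) x₀).symm y) v)
  rw [ofCoord_toCoord hy] at h
  rwa [(extChartAt (𝓡 n) x₀).right_inv hy]

/-- Conformality at the centers of the charts suffices, as `L_X g` does not depend on the chart. -/
lemma IsOneParameterGroup.isConformalWith (hφ : IsOneParameterGroup (𝓡 n) φ) {μ : M → ℝ}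
    (h : ∀ (x : M) (v : TangentSpace (𝓡 n) x),
      HasDerivAt (fun t => (inner ℝ (mfderiv (𝓡 n) (𝓡 n) (φ t) x v)
        (mfderiv (𝓡 n) (𝓡 n) (φ t) x v) : ℝ)) (μ x * inner ℝ v v) 0) :
    IsConformalWith (infinitesimalGenerator (𝓡 n) φ) μ := by
  intro x₀ y hy
  refine lieMetric_eq_of_self ((contDiffAt_metricCoord hy).differentiableAt (by simp))
    (Eventually.of_forall fun z => metricCoord_symm x₀ z) fun u => ?_
  rw [metricCoord_apply]
  exact (hφ.hasDerivAt_inner hy u).unique (h _ _)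

lemma IsConformalWith.hasDerivAt_inner (hφ : IsOneParameterGroup (𝓡 n) φ) {μ : M → ℝ}
    (h : IsConformalWith (infinitesimalGenerator (𝓡 n) φ) μ) (x : M) (v : TangentSpace (𝓡 n) x) :
    HasDerivAt (fun t => (inner ℝ (mfderiv (𝓡 n) (𝓡 n) (φ t) x v)
        (mfderiv (𝓡 n) (𝓡 n) (φ t) x v) : ℝ)) (μ x * inner ℝ v v) 0 := by
  have hx := mem_extChartAt_source (I := 𝓡 n) x
  have h1 := hφ.hasDerivAt_inner_toCoord hx v
  rwa [h x _ ((extChartAt (𝓡 n) x).map_source hx), (extChartAt (𝓡 n) x).left_inv hx,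
    metricCoord_toCoord hx] at h1

/-- A flow of homotheties has a constant infinitesimal scale factor. -/
lemma GeneratesHomotheties.exists_isConformalWith [Nonempty M] [NeZero n]
    {X : (x : M) → TangentSpace (𝓡 n) x} (h : GeneratesHomotheties X) :
    ∃ μ : ℝ, IsConformalWith X fun _ => μ := by
  obtain ⟨φ, hφ, rfl, hh⟩ := h
  choose c hc hinner using fun t => (hh t).2
  obtain ⟨x⟩ := ‹Nonempty M›
  obtain ⟨v, hv⟩ : ∃ v : TangentSpace (𝓡 n) x, v ≠ 0 :=
    exists_ne (0 : EuclideanSpace ℝ (Fin n))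
  have hv' : (inner ℝ v v : ℝ) ≠ 0 := (real_inner_self_pos.2 hv).ne'
  have hd := hφ.hasDerivAt_inner_toCoord (mem_extChartAt_source (I := 𝓡 n) x) v
  obtain ⟨μ, hμ⟩ : ∃ μ, HasDerivAt c μ 0 := by
    refine ⟨_, (hd.div_const (inner ℝ v v)).congr_of_eventuallyEq (Eventually.of_forall fun t => ?_)⟩
    simp only [hinner]
    field_simp
  refine ⟨μ, hφ.isConformalWith fun x w => ?_⟩
  simp only [hinner]
  exact hμ.mul_const _

/-- A conformal field with constant infinitesimal scale factor generates homotheties: the squared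
length of a transported vector solves `h' = μ h`. -/
lemma IsConformalWith.generatesHomotheties (hφ : IsOneParameterGroup (𝓡 n) φ) {μ : ℝ}
    (h : IsConformalWith (infinitesimalGenerator (𝓡 n) φ) fun _ => μ) :
    GeneratesHomotheties (infinitesimalGenerator (𝓡 n) φ) := by
  have hmd : ∀ t x, MDifferentiableAt (𝓡 n) (𝓡 n) (φ t) x := fun t x =>
    (hφ.contMDiff_apply t).mdifferentiable (by simp) x
  have hnorm : ∀ (x : M) (v : TangentSpace (𝓡 n) x) (t : ℝ),
      (inner ℝ (mfderiv (𝓡 n) (𝓡 n) (φ t) x v) (mfderiv (𝓡 n) (𝓡 n) (φ t) x v) : ℝ) =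
        Real.exp (μ * t) * inner ℝ v v := by
    intro x v
    let H : ℝ → ℝ := fun t =>
      inner ℝ (mfderiv (𝓡 n) (𝓡 n) (φ t) x v) (mfderiv (𝓡 n) (𝓡 n) (φ t) x v)
    have hH : ∀ t, HasDerivAt H (μ * H t) t := by
      intro t
      have h1 := h.hasDerivAt_inner hφ (φ t x) (mfderiv (𝓡 n) (𝓡 n) (φ t) x v)
      have h2 : ∀ s, H (s + t) = inner ℝ
          (mfderiv (𝓡 n) (𝓡 n) (φ s) (φ t x) (mfderiv (𝓡 n) (𝓡 n) (φ t) x v))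
          (mfderiv (𝓡 n) (𝓡 n) (φ s) (φ t x) (mfderiv (𝓡 n) (𝓡 n) (φ t) x v)) := by
        intro s
        have hst : φ (s + t) = φ s ∘ φ t := funext (hφ.map_add s t)
        have hk : mfderiv (𝓡 n) (𝓡 n) (φ s ∘ φ t) x v =
            mfderiv (𝓡 n) (𝓡 n) (φ s) (φ t x) (mfderiv (𝓡 n) (𝓡 n) (φ t) x v) :=
          congrArg (fun L => L v) (mfderiv_comp x (hmd s (φ t x)) (hmd t x))
        simp only [H]
        rw [hst, hk]
      have h3 : HasDerivAt (fun s => H (s + t)) (μ * H t) 0 := by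
        simp only [h2]
        exact h1
      have h4 := HasDerivAt.comp_sub_const (x := t) (a := t) (f := fun s => H (s + t)) (f' := μ * H t)
        (by simpa using h3)
      simpa using h4
    have hconst : ∀ t, H t * Real.exp (-(μ * t)) = H 0 * Real.exp (-(μ * 0)) := by
      have hd : ∀ t, HasDerivAt (fun t => H t * Real.exp (-(μ * t))) 0 t := by
        intro t
        have he : HasDerivAt (fun t => Real.exp (-(μ * t))) (Real.exp (-(μ * t)) * (-(μ * 1))) t :=
          (((hasDerivAt_id t).const_mul μ).neg).exp
        convert! (hH t).mul he using 1
        ring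
      exact fun t => is_const_of_deriv_eq_zero (fun t => (hd t).differentiableAt)
        (fun t => (hd t).deriv) t 0
    intro t
    have h0 : H 0 = inner ℝ v v := by
      have hid : φ 0 = id := funext hφ.map_zero
      simp only [H]
      rw [hid, mfderiv_id]
      rfl
    have ht := hconst t
    rw [mul_zero, neg_zero, Real.exp_zero, mul_one, h0, Real.exp_neg] at ht
    have := Real.exp_ne_zero (μ * t)
    field_simp at ht
    linarith
  refine ⟨φ, hφ, rfl, fun t => ⟨⟨⟨⟨φ t, φ (-t), fun x => ?_, fun x => ?_⟩, hφ.contMDiff_apply t,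
    hφ.contMDiff_apply (-t)⟩, rfl⟩, Real.exp (μ * t), Real.exp_pos _, fun x v w => ?_⟩⟩
  · rw [← hφ.map_add, neg_add_cancel, hφ.map_zero]
  · rw [← hφ.map_add, add_neg_cancel, hφ.map_zero]
  · have h1 := hnorm x (v + w) t
    have h2 := hnorm x v t
    have h3 := hnorm x w t
    rw [map_add, real_inner_add_add_self, real_inner_add_add_self] at h1
    linarith

end Homothety

/-! ### The bracket of the complete lift with `f₁` -/

section Bracket

variable {M : Type*} [TopologicalSpace M] [ChartedSpace (EuclideanSpace ℝ (Fin 2)) M]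
  [IsManifold (𝓡 2) ∞ M] [RiemannianBundle (fun x : M => TangentSpace (𝓡 2) x)]
  [IsContMDiffRiemannianBundle (𝓡 2) ∞ (EuclideanSpace ℝ (Fin 2))
      (fun x : M => TangentSpace (𝓡 2) x)]
  {o : (x : M) → Orientation ℝ (TangentSpace (𝓡 2) x) (Fin 2)} {U : Set M}
  {X : (x : M) → TangentSpace (𝓡 2) x}

/-- The bracket `[X⃗, f₁]` at `(x, R)` has the components `(L_X J) R` and, when the former vanishes,
`-(L_X Γ)(J R, R)`. -/
lemma mlieBracket_completeLift_f₁_eq_zero_iff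
    (hX : ContMDiff (𝓡 2) (𝓡 2).tangent ∞ (fun x => (⟨x, X x⟩ : TangentBundle (𝓡 2) M)))
    (hXc : IsCompleteField (𝓡 2) X) (ho : IsOrientationOn U o) (x : M) (hx : x ∈ U)
    (r : EuclideanSpace ℝ (Fin 2)) :
    VectorField.mlieBracket (𝓡 2).tangent (completeLift (𝓡 2) hXc) (f₁ o)
        (⟨x, r⟩ : TangentBundle (𝓡 2) M) = 0 ↔
      lieEndo (rotCoord o x) (fieldCoord X x) (extChartAt (𝓡 2) x x) r = 0 ∧
      lieConnection (christoffelCoord x) (fieldCoord X x) (extChartAt (𝓡 2) x x)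
        (rotCoord o x (extChartAt (𝓡 2) x x) r) r = 0 := by
  have hy := mem_extChartAt_target (I := 𝓡 2) x
  have hyU : (extChartAt (𝓡 2) x).symm (extChartAt (𝓡 2) x x) ∈ U := by rwa [extChartAt_to_inv]
  have hp : extChartAt (𝓡 2).tangent (⟨x, r⟩ : TangentBundle (𝓡 2) M) ⟨x, r⟩ =
      (extChartAt (𝓡 2) x x, r) := by
    rw [extChartAt_tangent (by exact mem_extChartAt_source x)]
    exact Prod.ext rfl (toCoord_self x r)
  have hev : ∀ᶠ z : EuclideanSpace ℝ (Fin 2) × EuclideanSpace ℝ (Fin 2) in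
      𝓝 (extChartAt (𝓡 2).tangent (⟨x, r⟩ : TangentBundle (𝓡 2) M) ⟨x, r⟩),
      z.1 ∈ (extChartAt (𝓡 2) x).target := by
    rw [hp]
    exact continuousAt_fst.eventually ((isOpen_extChartAt_target x).eventually_mem hy)
  have hflow := hXc.choose_spec
  rw [mlieBracket_eq_zero_iff (V' := fun z => (fieldCoord X x z.1, fderiv ℝ (fieldCoord X x) z.1 z.2))
    (W' := fun z => (rotCoord o x z.1 z.2,
      -rotCoord o x z.1 z.2 - christoffelCoord x z.1 (rotCoord o x z.1 z.2) z.2))]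
  · rw [hp, lieBracket_completeLift ((contDiffAt_fieldCoord hX hy).of_le ENat.LEInfty.out)
      (differentiableAt_rotCoord ho hy hyU)
      ((contDiffAt_christoffelCoord hy).differentiableAt (by simp))]
    refine ⟨fun h => ?_, fun h => ?_⟩
    · have h1 := (Prod.mk.inj h).1
      have h2 := (Prod.mk.inj h).2
      refine ⟨h1, ?_⟩
      rw [h1] at h2
      simpa using h2
    · rw [h.1, h.2]
      simp
  · filter_upwards [hev] with z hz
    rw [show z = (z.1, z.2) from rfl, extChartAt_tangent_symm (by exact hz)]
    have h := hflow.1.mfderiv_extChartAt_completeLift (p := ⟨x, r⟩) (by exact hz) z.2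
    rw [hflow.2] at h
    exact h.symm
  · filter_upwards [hev] with z hz
    rw [show z = (z.1, z.2) from rfl, extChartAt_tangent_symm (by exact hz)]
    exact (mfderiv_extChartAt_f₁ (p := ⟨x, r⟩) (by exact hz) z.2).symm

lemma IsConformalWith.differentiableAt {μ : M → ℝ} (h : IsConformalWith X μ)
    (hX : ContMDiff (𝓡 2) (𝓡 2).tangent ∞ (fun x => (⟨x, X x⟩ : TangentBundle (𝓡 2) M)))
    {x₀ : M} {y : EuclideanSpace ℝ (Fin 2)} (hy : y ∈ (extChartAt (𝓡 2) x₀).target) :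
    DifferentiableAt ℝ (μ ∘ (extChartAt (𝓡 2) x₀).symm) y := by
  obtain ⟨e, he⟩ := exists_ne (0 : EuclideanSpace ℝ (Fin 2))
  have hX' := contDiffAt_fieldCoord hX hy
  have hX1 : DifferentiableAt ℝ (fieldCoord X x₀) y := hX'.differentiableAt (by simp)
  have hX2 : DifferentiableAt ℝ (fun z => fderiv ℝ (fieldCoord X x₀) z e) y :=
    ((hX'.fderiv_right (m := ∞) (by simp)).differentiableAt (by simp)).clm_apply
      (differentiableAt_const e)
  have hG := contDiffAt_metricCoord hy
  have hG1 : DifferentiableAt ℝ (metricCoord x₀) y := hG.differentiableAt (by simp)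
  have hG2 : DifferentiableAt ℝ (fderiv ℝ (metricCoord x₀)) y :=
    (hG.fderiv_right (m := ∞) (by simp)).differentiableAt (by simp)
  have hc : DifferentiableAt ℝ (fun _ : EuclideanSpace ℝ (Fin 2) => e) y := differentiableAt_const e
  have hL : DifferentiableAt ℝ (fun z => lieMetric (metricCoord x₀) (fieldCoord X x₀) z e e) y :=
    ((((hG2.clm_apply hX1).clm_apply hc).clm_apply hc).add
      ((hG1.clm_apply hX2).clm_apply hc)).add ((hG1.clm_apply hc).clm_apply hX2)
  refine (hL.mul (((hG1.clm_apply hc).clm_apply hc).inv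
    (metricCoord_pos hy he).ne')).congr_of_eventuallyEq ?_
  filter_upwards [(isOpen_extChartAt_target x₀).mem_nhds hy] with z hz
  have := (metricCoord_pos hz he).ne'
  simp only [Pi.mul_apply, Pi.inv_apply, h x₀ z hz]
  rw [Function.comp_apply]
  field_simp

/-- For a conformal field with scale factor `μ`, the Lie derivative of the connection is
`G((L_X Γ)(u, v), w) = (dμ(u) G(v, w) + dμ(v) G(u, w) - dμ(w) G(u, v)) / 2`. -/
lemma IsConformalWith.metricCoord_lieConnection {μ : M → ℝ} (h : IsConformalWith X μ)
    (hX : ContMDiff (𝓡 2) (𝓡 2).tangent ∞ (fun x => (⟨x, X x⟩ : TangentBundle (𝓡 2) M)))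
    {x₀ : M} {y : EuclideanSpace ℝ (Fin 2)} (hy : y ∈ (extChartAt (𝓡 2) x₀).target)
    (u v w : EuclideanSpace ℝ (Fin 2)) :
    metricCoord x₀ y (lieConnection (christoffelCoord x₀) (fieldCoord X x₀) y u v) w =
      (1 / 2) * (fderiv ℝ (μ ∘ (extChartAt (𝓡 2) x₀).symm) y u * metricCoord x₀ y v w
        + fderiv ℝ (μ ∘ (extChartAt (𝓡 2) x₀).symm) y v * metricCoord x₀ y u w
        - fderiv ℝ (μ ∘ (extChartAt (𝓡 2) x₀).symm) y w * metricCoord x₀ y u v) := by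
  have ht := (isOpen_extChartAt_target (I := 𝓡 2) x₀).eventually_mem hy
  exact metric_lieConnection ((contDiffAt_metricCoord hy).of_le ENat.LEInfty.out)
    ((contDiffAt_fieldCoord hX hy).of_le ENat.LEInfty.out)
    ((contDiffAt_christoffelCoord hy).differentiableAt (by simp)) (h.differentiableAt hX hy)
    (Eventually.of_forall fun z => metricCoord_symm x₀ z)
    (ht.mono fun z hz => koszul_christoffelCoord hz) (ht.mono fun z hz => h x₀ z hz) u v w

/-- A conformal field with constant scale factor commutes with `f₁`. -/
lemma IsConformalWith.mlieBracket_eq_zero {μ : ℝ} (h : IsConformalWith X fun _ => μ)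
    (hX : ContMDiff (𝓡 2) (𝓡 2).tangent ∞ (fun x => (⟨x, X x⟩ : TangentBundle (𝓡 2) M)))
    (hXc : IsCompleteField (𝓡 2) X) (ho : IsOrientationOn U o) (p : TangentBundle (𝓡 2) M)
    (hp : p.1 ∈ U) :
    VectorField.mlieBracket (𝓡 2).tangent (completeLift (𝓡 2) hXc) (f₁ o) p = 0 := by
  obtain ⟨x, R⟩ := p
  suffices key : ∀ r : EuclideanSpace ℝ (Fin 2), VectorField.mlieBracket (𝓡 2).tangent
      (completeLift (𝓡 2) hXc) (f₁ o) (⟨x, r⟩ : TangentBundle (𝓡 2) M) = 0 from key R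
  intro r
  have hy := mem_extChartAt_target (I := 𝓡 2) x
  have hrot := isRightAngleRotation_rotCoord (o := o) hy
  refine (mlieBracket_completeLift_f₁_eq_zero_iff hX hXc ho x hp r).2 ⟨?_, ?_⟩
  · exact lieEndo_eq_zero_of_lieMetric_eq (by simp)
      ((contDiffAt_metricCoord hy).differentiableAt (by simp))
      (differentiableAt_rotCoord ho hy (by rwa [extChartAt_to_inv]))
      (((isOpen_extChartAt_target x).eventually_mem hy).mono
        fun z hz => isRightAngleRotation_rotCoord hz) (h x _ hy) r
  · refine hrot.eq_zero_of_apply_self ?_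
    rw [h.metricCoord_lieConnection hX hy,
      show (fun _ : M => μ) ∘ (extChartAt (𝓡 2) x).symm = fun _ => μ from rfl, fderiv_const_apply]
    simp

/-- A complete field that commutes with `f₁` is conformal with a constant scale factor. -/
lemma exists_isConformalWith_of_mlieBracket_eq_zero [PreconnectedSpace M] [Nonempty M]
    (hX : ContMDiff (𝓡 2) (𝓡 2).tangent ∞ (fun x => (⟨x, X x⟩ : TangentBundle (𝓡 2) M)))
    (hXc : IsCompleteField (𝓡 2) X) {ι : Type*} {U : ι → Set M} (hcover : ⋃ i, U i = univ)
    {o : ι → (x : M) → Orientation ℝ (TangentSpace (𝓡 2) x) (Fin 2)}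
    (ho : ∀ i, IsOrientationOn (U i) (o i))
    (h : ∀ i, ∀ p : TangentBundle (𝓡 2) M, p.1 ∈ U i → p.2 ≠ 0 →
      VectorField.mlieBracket (𝓡 2).tangent (completeLift (𝓡 2) hXc) (f₁ (o i)) p = 0) :
    ∃ μ : ℝ, IsConformalWith X fun _ => μ := by
  have hcov : ∀ x : M, ∃ i, x ∈ U i := fun x => by
    have : x ∈ ⋃ i, U i := hcover ▸ mem_univ x
    simpa using this
  choose i hi using hcov
  have hflow := hXc.choose_spec
  -- The first component of the bracket shows that the field is conformal.
  have hconf : ∀ x : M, ∃ μ : ℝ, ∀ u v,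
      lieMetric (metricCoord x) (fieldCoord X x) (extChartAt (𝓡 2) x x) u v =
        μ * metricCoord x (extChartAt (𝓡 2) x x) u v := fun x => by
    have hy := mem_extChartAt_target (I := 𝓡 2) x
    refine exists_lieMetric_eq_of_lieEndo_eq_zero (J := rotCoord (o (i x)) x) (by simp)
      ((contDiffAt_metricCoord hy).differentiableAt (by simp))
      (differentiableAt_rotCoord (ho (i x)) hy (by rw [extChartAt_to_inv]; exact hi x))
      (((isOpen_extChartAt_target x).eventually_mem hy).mono
        fun z hz => isRightAngleRotation_rotCoord hz) fun r => ?_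
    rcases eq_or_ne r 0 with rfl | hr
    · simp [lieEndo]
    · exact ((mlieBracket_completeLift_f₁_eq_zero_iff hX hXc (ho (i x)) x (hi x) r).1
        (h (i x) ⟨x, r⟩ (hi x) hr)).1
  choose μ hμ using hconf
  have hX' : IsConformalWith X μ := by
    have hc := hflow.1.isConformalWith (μ := μ) fun x v => by
      have hx := mem_extChartAt_source (I := 𝓡 2) x
      have hd := hflow.1.hasDerivAt_inner_toCoord hx v
      rwa [hflow.2, hμ, metricCoord_toCoord hx] at hd
    rwa [hflow.2] at hc
  -- The second component shows that the differential of the scale factor vanishes.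
  have hzero : ∀ x, HasMFDerivAt (𝓡 2) 𝓘(ℝ, ℝ) μ x 0 := fun x => by
    have hy := mem_extChartAt_target (I := 𝓡 2) x
    have hrot := isRightAngleRotation_rotCoord (o := o (i x)) hy
    obtain ⟨r, hr⟩ := exists_ne (0 : EuclideanSpace ℝ (Fin 2))
    have h2 := ((mlieBracket_completeLift_f₁_eq_zero_iff hX hXc (ho (i x)) x (hi x) r).1
      (h (i x) ⟨x, r⟩ (hi x) hr)).2
    have hδ := hrot.form_eq_zero (by simp)
      (δ := fderiv ℝ (μ ∘ (extChartAt (𝓡 2) x).symm) (extChartAt (𝓡 2) x x)) hr fun w => by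
        have h3 := hX'.metricCoord_lieConnection hX hy
          (rotCoord (o (i x)) x (extChartAt (𝓡 2) x x) r) r w
        rw [h2, map_zero, _root_.zero_apply] at h3
        linarith
    have hd := (hX'.differentiableAt hX hy).hasFDerivAt
    rw [hδ] at hd
    have hm := (hd.hasMFDerivAt.comp x (mdifferentiableAt_chart
      (mem_extChartAt_source (I := 𝓡 2) x)).hasMFDerivAt).congr_mfderiv
        (ContinuousLinearMap.zero_comp _)
    refine hm.congr_of_eventuallyEq ?_
    filter_upwards [extChartAt_source_mem_nhds (I := 𝓡 2) x] with z hz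
    rw [Function.comp_apply, Function.comp_apply, (extChartAt (𝓡 2) x).left_inv hz]
  obtain ⟨x₁⟩ := ‹Nonempty M›
  refine ⟨μ x₁, ?_⟩
  convert hX' using 2 with x
  exact (isLocallyConstant_of_hasMFDerivAt_zero hzero).apply_eq_of_preconnectedSpace x₁ x

end Bracket

end CurvatureRadii

theorem mainTheorem8 {M : Type*} [TopologicalSpace M] [T2Space M] [ConnectedSpace M]
    [ChartedSpace (EuclideanSpace ℝ (Fin 2)) M] [IsManifold (𝓡 2) ∞ M]
    [RiemannianBundle (fun x : M => TangentSpace (𝓡 2) x)]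
    [IsContMDiffRiemannianBundle (𝓡 2) ∞ (EuclideanSpace ℝ (Fin 2))
      (fun x : M => TangentSpace (𝓡 2) x)]
    (X : (x : M) → TangentSpace (𝓡 2) x)
    (hX : ContMDiff (𝓡 2) (𝓡 2).tangent ∞ (fun x => (⟨x, X x⟩ : TangentBundle (𝓡 2) M)))
    (hXc : CurvatureRadii.IsCompleteField (𝓡 2) X)
    {ι : Type*} (U : ι → Set M) (hU : ∀ i, IsOpen (U i)) (hcover : ⋃ i, U i = Set.univ)
    (o : ι → (x : M) → Orientation ℝ (TangentSpace (𝓡 2) x) (Fin 2))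
    (ho : ∀ i, CurvatureRadii.IsOrientationOn (U i) (o i)) :
    CurvatureRadii.GeneratesHomotheties X ↔
      ∀ i, ∀ p : TangentBundle (𝓡 2) M, p.1 ∈ U i → p.2 ≠ 0 →
        VectorField.mlieBracket (𝓡 2).tangent (CurvatureRadii.completeLift (𝓡 2) hXc)
          (CurvatureRadii.f₁ (o i)) p = 0 := by
  refine ⟨fun h i p hp _ => ?_, fun h => ?_⟩
  · obtain ⟨μ, hμ⟩ := h.exists_isConformalWith
    exact hμ.mlieBracket_eq_zero hX hXc (ho i) p hp
  · obtain ⟨μ, hμ⟩ :=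
      CurvatureRadii.exists_isConformalWith_of_mlieBracket_eq_zero hX hXc hcover ho h
    obtain ⟨φ, hφ, rfl⟩ := hXc
    exact hμ.generatesHomotheties hφ
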